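/- Let $k>0$, let $\Lambda\subset\mathbb{C}^k$ be a lattice (a discrete subgroup spanning $\mathbb{C}^k$ over $\mathbb{R}$) and let $T=\mathbb{C}^k/\Lambda$ be the corresponding complex torus, so that $\pi_1(T)=\Lambda$. Let $M$ be a connected compact complex manifold, and let $\operatorname{Aut} M$ be the group of its biholomorphic automorphisms with the compact-open topology. Let $\Lambda$ act on $M$ by biholomorphisms via a homomorphism $\rho:\Lambda\to\operatorname{Aut}M$ that factors through a compact subgroup of $\operatorname{Aut} M$. Let $$X:=\mathbb{C}^k\times^\Lambda M=(\mathbb{C}^k\times M)/\Lambda,$$ the quotient by the diagonal action $\lambda\cdot(u,m)=(u+\lambda,\rho(\lambda)m)$. Then the holomorphic tangent bundle $\Theta_X$ of $X$ is not big. Here a line bundle $L$ over a compact complex manifold $Y$ is called big if there is a $C>0$ such that $h^0(Y,L^{\otimes m})\ge C\,m^{\dim Y}$ for all sufficiently large and divisible $m$, and a holomorphic vector bundle $E$ over $X$ is called big if the line bundle $\mathcal{O}_{\mathbb{P}E^\vee}(1)$ over the projective bundle $\mathbb{P}E^\vee$ of lines in the dual bundle $E^\vee$ is big. -/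

import Mathlib

open Bundle
open scoped Manifold ContDiff Topology ENNReal LinearAlgebra.Projectivization

set_option linter.unusedSectionVars false

noncomputable section

section Quotients

/-- The quotient of a complex manifold by a group acting by biholomorphisms, such that the quotient map
is a local homeomorphism, is a complex manifold for the charts pushed forward from above. -/
theorem isManifold_chartedSpaceOfRightInverse {E Y Z G : Type*}
    [NormedAddCommGroup E] [NormedSpace ℂ E] {n : WithTop ℕ∞}
    [TopologicalSpace Y] [ChartedSpace E Y] [IsManifold 𝓘(ℂ, E) n Y] [TopologicalSpace Z]
    [Group G] [MulAction G Y]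
    (hG : ∀ γ : G, ContMDiff 𝓘(ℂ, E) 𝓘(ℂ, E) n (fun y : Y => γ • y))
    {f : Y → Z} (hf : IsLocalHomeomorph f)
    (horb : ∀ y y' : Y, f y = f y' → ∃ γ : G, y' = γ • y) (hinv : ∀ (γ : G) (y : Y), f (γ • y) = f y)
    {g : Z → Y} (hg : Function.RightInverse g f) :
    @IsManifold ℂ _ E _ _ E _ 𝓘(ℂ, E) n Z _ (hf.chartedSpaceOfRightInverse hg) := by
  let := hf.chartedSpaceOfRightInverse (H := E) hg
  apply isManifold_of_contDiffOn
  rintro _ _ ⟨q, rfl⟩ ⟨q', rfl⟩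
  intro z hz
  apply ContDiffAt.contDiffWithinAt
  set L := hf.localInverseAt (g q) with hL
  set L' := hf.localInverseAt (g q') with hL'
  set c := chartAt E (g q) with hc
  set c' := chartAt E (g q') with hc'
  have hLs : ∀ y, L.symm y = f y := fun y => by rw [hL, hf.localInverseAt_symm]
  have hL's : ∀ y, L'.symm y = f y := fun y => by rw [hL', hf.localInverseAt_symm]
  simp only [modelWithCornersSelf_coe, modelWithCornersSelf_coe_symm, Set.range_id, Set.inter_univ,
    Set.preimage_id, OpenPartialHomeomorph.trans_source, OpenPartialHomeomorph.trans_symm_eq_symm_trans_symm,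
    OpenPartialHomeomorph.symm_source, Set.mem_inter_iff, Set.mem_preimage,
    OpenPartialHomeomorph.coe_trans, Function.comp_apply, hLs] at hz
  obtain ⟨⟨hz1, hz2⟩, hz3, hz4⟩ := hz
  set y := c.symm z with hy
  obtain ⟨γ, hγ⟩ := horb y (L' (f y)) ((hL's _).symm.trans (L'.left_inv hz3)).symm
  have hcont : ContinuousAt (fun y : Y => γ • y) y := (hG γ).continuous.continuousAt
  have hmem : γ • y ∈ L'.target := hγ ▸ L'.map_source hz3
  have hcs : ContinuousAt c.symm z := c.continuousAt_symm hz1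
  have key : ∀ᶠ w in 𝓝 z, c' (L' (f (c.symm w))) = c' (γ • c.symm w) := by
    have h1 : ∀ᶠ w in 𝓝 z, γ • c.symm w ∈ L'.target :=
      (hcont.comp_of_eq hcs rfl).eventually (L'.open_target.mem_nhds hmem)
    filter_upwards [h1] with w hw
    congr 1
    rw [← hinv γ, ← hL's, L'.right_inv hw]
  have main : ContMDiffAt 𝓘(ℂ, E) 𝓘(ℂ, E) n (fun w => c' (γ • c.symm w)) z := by
    have a1 : ContMDiffAt 𝓘(ℂ, E) 𝓘(ℂ, E) n c.symm z :=
      (contMDiffOn_chart_symm (I := 𝓘(ℂ, E)) (x := g q)).contMDiffAt (c.open_target.mem_nhds hz1)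
    have a2 : ContMDiffAt 𝓘(ℂ, E) 𝓘(ℂ, E) n (fun y : Y => γ • y) (c.symm z) := hG γ _
    have a3 : ContMDiffAt 𝓘(ℂ, E) 𝓘(ℂ, E) n c' (γ • c.symm z) :=
      (contMDiffOn_chart (I := 𝓘(ℂ, E)) (x := g q')).contMDiffAt
        (c'.open_source.mem_nhds (by rw [← hy, ← hγ]; exact hz4))
    exact a3.comp z (a2.comp z a1)
  refine main.contDiffAt.congr_of_eventuallyEq ?_
  filter_upwards [key] with w hw
  simpa [hLs] using hw

end Quotients

section Suspension

/-- The group `Aut M` of biholomorphic maps of a complex manifold `M` onto itself. Over `ℂ`, the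
regularity `ω` (analytic) means holomorphic. -/
def HolAut (E M : Type*) [NormedAddCommGroup E] [NormedSpace ℂ E] [TopologicalSpace M]
    [ChartedSpace E M] : Subgroup (M ≃ₜ M) where
  carrier := {φ | ContMDiff 𝓘(ℂ, E) 𝓘(ℂ, E) ω φ ∧ ContMDiff 𝓘(ℂ, E) 𝓘(ℂ, E) ω φ.symm}
  one_mem' := ⟨contMDiff_id, contMDiff_id⟩
  mul_mem' := fun ha hb => ⟨ha.1.comp hb.1, hb.2.comp ha.2⟩
  inv_mem' := fun ha => ⟨ha.2, ha.1⟩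

/-- The compact-open topology on `Aut M`. -/
instance HolAut.instTopologicalSpace (E M : Type*) [NormedAddCommGroup E] [NormedSpace ℂ E]
    [TopologicalSpace M] [ChartedSpace E M] : TopologicalSpace (HolAut E M) :=
  TopologicalSpace.induced (fun φ => ((φ : M ≃ₜ M) : C(M, M))) inferInstance

variable {k : ℕ} {E M : Type*} [NormedAddCommGroup E] [NormedSpace ℂ E]
    [TopologicalSpace M] [ChartedSpace E M]

/-- The product `ℂᵏ × M`, carrying the diagonal action of `Λ ⊆ ℂᵏ`, by translations on `ℂᵏ` and through
`ρ` on `M`. -/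
def SuspCover {Λ : Submodule ℤ (EuclideanSpace ℂ (Fin k))}
    (_ρ : Multiplicative Λ →* HolAut E M) : Type _ :=
  EuclideanSpace ℂ (Fin k) × M

namespace SuspCover

variable {Λ : Submodule ℤ (EuclideanSpace ℂ (Fin k))} (ρ : Multiplicative Λ →* HolAut E M)

instance : TopologicalSpace (SuspCover ρ) :=
  instTopologicalSpaceProd

instance : ChartedSpace (EuclideanSpace ℂ (Fin k) × E) (SuspCover ρ) :=
  prodChartedSpace (EuclideanSpace ℂ (Fin k)) (EuclideanSpace ℂ (Fin k)) E M

instance [IsManifold 𝓘(ℂ, E) ω M] :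
    IsManifold 𝓘(ℂ, EuclideanSpace ℂ (Fin k) × E) ω (SuspCover ρ) := by
  have h : IsManifold (𝓘(ℂ, EuclideanSpace ℂ (Fin k)).prod 𝓘(ℂ, E)) ω
    (EuclideanSpace ℂ (Fin k) × M) := inferInstance
  rw [modelWithCornersSelf_prod]
  exact h

instance [T2Space M] : T2Space (SuspCover ρ) :=
  inferInstanceAs (T2Space (EuclideanSpace ℂ (Fin k) × M))

instance [LocallyCompactSpace M] : LocallyCompactSpace (SuspCover ρ) :=
  inferInstanceAs (LocallyCompactSpace (EuclideanSpace ℂ (Fin k) × M))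

/-- `γ • (u, m) = (γ + u, ρ(γ) m)`. -/
instance : MulAction (Multiplicative Λ) (SuspCover ρ) where
  smul γ p := ((γ.toAdd : EuclideanSpace ℂ (Fin k)) + p.1, (ρ γ : M ≃ₜ M) p.2)
  one_smul p := Prod.ext (by simp [HSMul.hSMul]) (by simp [HSMul.hSMul])
  mul_smul γ δ p := Prod.ext (by simp [HSMul.hSMul, add_assoc]) (by simp [HSMul.hSMul])

theorem smul_def (γ : Multiplicative Λ) (p : SuspCover ρ) :
    γ • p = ((γ.toAdd : EuclideanSpace ℂ (Fin k)) + p.1, (ρ γ : M ≃ₜ M) p.2) := rfl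

theorem contMDiff_smul (γ : Multiplicative Λ) :
    ContMDiff 𝓘(ℂ, EuclideanSpace ℂ (Fin k) × E) 𝓘(ℂ, EuclideanSpace ℂ (Fin k) × E) ω
      (fun p : SuspCover ρ => γ • p) := by
  have h1 : ContMDiff 𝓘(ℂ, EuclideanSpace ℂ (Fin k)) 𝓘(ℂ, EuclideanSpace ℂ (Fin k)) ω
      (fun u => (γ.toAdd : EuclideanSpace ℂ (Fin k)) + u) :=
    (contDiff_const.add contDiff_id).contMDiff
  have h := h1.prodMap (ρ γ).2.1
  rw [modelWithCornersSelf_prod]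
  exact h

instance : ContinuousConstSMul (Multiplicative Λ) (SuspCover ρ) :=
  ⟨fun γ => (contMDiff_smul ρ γ).continuous⟩

instance : IsCancelSMul (Multiplicative Λ) (SuspCover ρ) where
  right_cancel' γ δ p h := by
    have h1 : ((γ.toAdd : EuclideanSpace ℂ (Fin k)) + p.1) = (δ.toAdd : EuclideanSpace ℂ (Fin k)) + p.1 :=
      congrArg Prod.fst h
    exact Multiplicative.toAdd.injective (Subtype.ext (add_right_cancel h1))

instance [DiscreteTopology Λ] : ProperlyDiscontinuousSMul (Multiplicative Λ) (SuspCover ρ) where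
  finite_disjoint_inter_image {K L} hK hL := by
    have : DiscreteTopology Λ.toAddSubgroup := ‹DiscreteTopology Λ›
    have hV := AddSubgroup.properlyDiscontinuousVAdd_of_tendsto_cofinite Λ.toAddSubgroup
      (AddSubgroup.tendsto_coe_cofinite_of_discrete Λ.toAddSubgroup ⟨this⟩)
    have hfst : Continuous (fun p : SuspCover ρ => p.1) := continuous_fst
    have hfin := hV.finite_disjoint_inter_image (hK.image hfst) (hL.image hfst)
    refine (hfin.preimage (Multiplicative.toAdd.injective.injOn)).subset ?_
    rintro γ ⟨_, ⟨p, hp, rfl⟩, hL'⟩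
    exact ⟨_, ⟨p.1, ⟨p, hp, rfl⟩, rfl⟩, ⟨_, hL', rfl⟩⟩

end SuspCover

/-- The bundle `ℂᵏ ×^Λ M = (ℂᵏ × M) / Λ`, the orbit space of the diagonal action. -/
def Susp {Λ : Submodule ℤ (EuclideanSpace ℂ (Fin k))} (ρ : Multiplicative Λ →* HolAut E M) :
    Type _ :=
  MulAction.orbitRel.Quotient (Multiplicative Λ) (SuspCover ρ)

namespace Susp

variable {Λ : Submodule ℤ (EuclideanSpace ℂ (Fin k))} (ρ : Multiplicative Λ →* HolAut E M)

/-- The quotient topology. -/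
instance : TopologicalSpace (Susp ρ) :=
  inferInstanceAs (TopologicalSpace (Quotient (MulAction.orbitRel (Multiplicative Λ) (SuspCover ρ))))

/-- The charts of the quotient: local inverses of the covering `ℂᵏ × M → (ℂᵏ × M) / Λ` followed by
charts of `ℂᵏ × M`. -/
instance [DiscreteTopology Λ] [T2Space M] [LocallyCompactSpace M] :
    ChartedSpace (EuclideanSpace ℂ (Fin k) × E) (Susp ρ) :=
  MulAction.instChartedSpaceQuotient (G := Multiplicative Λ) (M := SuspCover ρ)

instance [DiscreteTopology Λ] [T2Space M] [LocallyCompactSpace M] [IsManifold 𝓘(ℂ, E) ω M] :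
    IsManifold 𝓘(ℂ, EuclideanSpace ℂ (Fin k) × E) ω (Susp ρ) :=
  isManifold_chartedSpaceOfRightInverse (G := Multiplicative Λ) (SuspCover.contMDiff_smul ρ) _
    (fun y y' h => by
      obtain ⟨γ, hγ⟩ := MulAction.orbitRel_apply.1 (Quotient.exact h)
      exact ⟨γ⁻¹, by rw [← hγ]; exact (inv_smul_smul γ y').symm⟩)
    (fun γ y => Quotient.sound (MulAction.orbitRel_apply.2 ⟨γ, rfl⟩))
    Quotient.mk_surjective.hasRightInverse.choose_spec

instance [DiscreteTopology Λ] [T2Space M] [LocallyCompactSpace M] : T2Space (Susp ρ) :=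
  inferInstanceAs (T2Space (Quotient (MulAction.orbitRel (Multiplicative Λ) (SuspCover ρ))))

end Susp

end Suspension

section LineBundles

variable {Y ι : Type*} [TopologicalSpace Y]

/-- The `m`-th tensor power of a line bundle given by transition functions `g i j`: the line bundle with
transition functions `(g i j) ^ m`. -/
def lineTensorPower (L : VectorBundleCore ℂ Y ℂ ι) (m : ℕ) : VectorBundleCore ℂ Y ℂ ι where
  baseSet := L.baseSet
  isOpen_baseSet := L.isOpen_baseSet
  indexAt := L.indexAt
  mem_baseSet_at := L.mem_baseSet_at
  coordChange i j y := (L.coordChange i j y 1) ^ m • ContinuousLinearMap.id ℂ ℂ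
  coordChange_self i y hy v := by simp [L.coordChange_self i y hy]
  continuousOn_coordChange i j :=
    (((L.continuousOn_coordChange i j).clm_apply continuousOn_const).pow m).smul continuousOn_const
  coordChange_comp i j k y hy v := by
    have h := L.coordChange_comp i j k y hy 1
    have h2 : L.coordChange j k y (L.coordChange i j y 1) =
        L.coordChange i j y 1 * L.coordChange j k y 1 := by
      rw [← smul_eq_mul, ← map_smul, smul_eq_mul, mul_one]
    simp only [_root_.smul_apply, ContinuousLinearMap.id_apply, smul_eq_mul]
    rw [← h, h2]; ring

/-- `h⁰(Y, L)`, the dimension of the space of global holomorphic sections of `L`, with value `⊤` if that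
space is infinite-dimensional. -/
def hZero (E : Type*) [NormedAddCommGroup E] [NormedSpace ℂ E] [ChartedSpace E Y]
    (L : VectorBundleCore ℂ Y ℂ ι) : ℕ∞ :=
  Cardinal.toENat (Module.rank ℂ (ContMDiffSection 𝓘(ℂ, E) ℂ ω L.Fiber))

/-- A line bundle `L` over a compact complex manifold `Y` (modelled on `E`) is big if there is `C > 0` with
`h⁰(Y, L^m) ≥ C m ^ dim Y` for all sufficiently large and divisible `m`. -/
def IsBigLineBundle (E : Type*) [NormedAddCommGroup E] [NormedSpace ℂ E] [ChartedSpace E Y]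
    (L : VectorBundleCore ℂ Y ℂ ι) : Prop :=
  ∃ C : ℝ, 0 < C ∧ ∃ d : ℕ, 0 < d ∧ ∃ m₀ : ℕ, ∀ m : ℕ, m₀ ≤ m → d ∣ m →
    ENNReal.ofReal (C * (m : ℝ) ^ Module.finrank ℂ E) ≤ (hZero E (lineTensorPower L m) : ℝ≥0∞)

end LineBundles

section ProjectiveBundle


variable {X : Type*}

/-- The projective bundle `ℙ W` of lines (not hyperplanes) in a vector bundle `W` with typical fibre `F` over
a complex manifold `X` modelled on `B`: a point is a point of `X` and a line in the fibre of `W`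
over it. The spaces `B` and `F` are recorded because the complex structure below depends on them. -/
structure ProjBundle (B F : Type*) (W : X → Type*) [∀ x, AddCommGroup (W x)]
    [∀ x, Module ℂ (W x)] where
  base : X
  line : ℙ ℂ (W base)

namespace ProjBundle

/-- An enumeration of the indices different from `a`. -/
def otherIndex {r : ℕ} (a : Fin r) : Fin (r - 1) ≃ {c : Fin r // c ≠ a} :=
  (Fintype.equivFinOfCardEq (by simp)).symm

section AffineVec

variable {F : Type*} [NormedAddCommGroup F] [NormedSpace ℂ F] [FiniteDimensional ℂ F]

/-- The vector of `F` with `a`-th coordinate `1` and with the other coordinates `z`. -/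
def affineVec (a : Fin (Module.finrank ℂ F)) (z : Fin (Module.finrank ℂ F - 1) → ℂ) : F :=
  Module.finBasis ℂ F a + ∑ j, z j • Module.finBasis ℂ F (otherIndex a j)

theorem affineVec_coord_self (a : Fin (Module.finrank ℂ F))
    (z : Fin (Module.finrank ℂ F - 1) → ℂ) :
    (Module.finBasis ℂ F).coord a (affineVec a z) = 1 := by
  have h : ∀ j, (Finsupp.single ((otherIndex a j : Fin (Module.finrank ℂ F))) (1 : ℂ)) a = 0 :=
    fun j => Finsupp.single_eq_of_ne' (otherIndex a j).2
  simp only [affineVec, map_add, map_sum, map_smul, Module.Basis.coord_apply,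
    Module.Basis.repr_self, h, smul_zero, Finset.sum_const_zero, add_zero,
    Finsupp.single_eq_same]

theorem affineVec_coord_other (a : Fin (Module.finrank ℂ F))
    (z : Fin (Module.finrank ℂ F - 1) → ℂ) (j : Fin (Module.finrank ℂ F - 1)) :
    (Module.finBasis ℂ F).coord (otherIndex a j) (affineVec a z) = z j := by
  have h0 : (Finsupp.single a (1 : ℂ)) (otherIndex a j : Fin (Module.finrank ℂ F)) = 0 :=
    Finsupp.single_eq_of_ne (otherIndex a j).2
  simp only [affineVec, map_add, map_sum, map_smul, Module.Basis.coord_apply,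
    Module.Basis.repr_self, h0, zero_add, smul_eq_mul]
  rw [Finset.sum_eq_single j]
  · simp
  · intro b _ hb
    rw [Finsupp.single_eq_of_ne, mul_zero]
    intro h
    exact hb ((otherIndex a).injective (Subtype.ext h.symm))
  · simp

theorem affineVec_ne_zero (a : Fin (Module.finrank ℂ F))
    (z : Fin (Module.finrank ℂ F - 1) → ℂ) : affineVec a z ≠ 0 := fun h => by
  simpa [h] using affineVec_coord_self a z

theorem eq_smul_affineVec (a : Fin (Module.finrank ℂ F)) (f : F)
    (hf : (Module.finBasis ℂ F).coord a f ≠ 0) :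
    f = (Module.finBasis ℂ F).coord a f • affineVec a (fun j =>
      (Module.finBasis ℂ F).coord (otherIndex a j) f / (Module.finBasis ℂ F).coord a f) := by
  apply (Module.finBasis ℂ F).ext_elem
  intro c
  rw [← Module.Basis.coord_apply, ← Module.Basis.coord_apply, map_smul, smul_eq_mul]
  by_cases hc : c = a
  · subst hc; rw [affineVec_coord_self, mul_one]
  · obtain ⟨j, hj⟩ := (otherIndex a).surjective ⟨c, hc⟩
    have hj' : c = otherIndex a j := by rw [hj]
    rw [hj', affineVec_coord_other]
    field_simp

theorem contDiff_affineVec (a : Fin (Module.finrank ℂ F)) {n : WithTop ℕ∞} :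
    ContDiff ℂ n (affineVec a : _ → F) := by
  unfold affineVec
  fun_prop

end AffineVec

variable (B F : Type*) [NormedAddCommGroup B] [NormedSpace ℂ B]
  [NormedAddCommGroup F] [NormedSpace ℂ F] [FiniteDimensional ℂ F]
  [TopologicalSpace X] [ChartedSpace B X]
  (W : X → Type*) [∀ x, AddCommGroup (W x)] [∀ x, Module ℂ (W x)] [∀ x, TopologicalSpace (W x)]
  [TopologicalSpace (TotalSpace F W)] [FiberBundle F W] [VectorBundle ℂ F W]

/-- The homogeneous coordinate with index `i.2` on the fibre of `W` over `x`, in the trivialization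
`trivializationAt F W i.1`. -/
def homCoord (i : X × Fin (Module.finrank ℂ F)) (x : X) : W x →ₗ[ℂ] ℂ :=
  (Module.finBasis ℂ F).coord i.2 ∘ₗ (trivializationAt F W i.1).linearMapAt ℂ x

variable {F W} in
/-- The vector of `W x` that the trivialization at `x₀` sends to `f` (if `x` is not in its base set,
the trivialization at `x` is used instead). -/
def localVec (x₀ x : X) (f : F) : W x :=
  open Classical in
  if x ∈ (trivializationAt F W x₀).baseSet then (trivializationAt F W x₀).symmₗ ℂ x f
  else (trivializationAt F W x).symmₗ ℂ x f

variable {F W} in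
theorem localVec_ne_zero (x₀ x : X) {f : F} (hf : f ≠ 0) : (localVec x₀ x f : W x) ≠ 0 := by
  have key : ∀ y, x ∈ (trivializationAt F W y).baseSet →
      (trivializationAt F W y).symmₗ ℂ x f ≠ 0 := by
    intro y hy h
    apply hf
    have h2 := (trivializationAt F W y).linearMapAt_symmₗ (R := ℂ) hy f
    rw [h, map_zero] at h2
    exact h2.symm
  unfold localVec
  split_ifs with h
  · exact key _ h
  · exact key _ (mem_baseSet_trivializationAt F W x)

variable {F W} in
theorem linearMapAt_localVec {x₀ x : X} (hx : x ∈ (trivializationAt F W x₀).baseSet) (f : F) :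
    (trivializationAt F W x₀).linearMapAt ℂ x (localVec x₀ x f) = f := by
  rw [localVec, if_pos hx]
  exact (trivializationAt F W x₀).linearMapAt_symmₗ (R := ℂ) hx f

variable {F W} in
theorem linearMapAt_localVec' {x₀ x₁ x : X} (hx : x ∈ (trivializationAt F W x₀).baseSet)
    (hx₁ : x ∈ (trivializationAt F W x₁).baseSet) (f : F) :
    (trivializationAt F W x₁).linearMapAt ℂ x (localVec x₀ x f) =
      (trivializationAt F W x₀).coordChangeL ℂ (trivializationAt F W x₁) x f := by
  rw [localVec, if_pos hx, Trivialization.coordChangeL_apply _ _ ⟨hx, hx₁⟩,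
    Trivialization.coe_linearMapAt_of_mem _ hx₁, Trivialization.coe_symmₗ _ hx]

variable {F W} in
theorem localVec_linearMapAt {x₀ x : X} (hx : x ∈ (trivializationAt F W x₀).baseSet) (w : W x) :
    localVec x₀ x ((trivializationAt F W x₀).linearMapAt ℂ x w) = w := by
  rw [localVec, if_pos hx]
  exact (trivializationAt F W x₀).symmₗ_linearMapAt (R := ℂ) hx w

/-- The quotient of two homogeneous coordinates, as a function on `ℙ W`. -/
def coordRatio (i j : X × Fin (Module.finrank ℂ F)) (p : ProjBundle B F W) : ℂ :=
  homCoord F W i p.base p.line.rep / homCoord F W j p.base p.line.rep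

/-- The open set of `ℙ W` over the `i.1`-th chart and trivialization where the homogeneous coordinate `i`
does not vanish. -/
def domain (i : X × Fin (Module.finrank ℂ F)) : Set (ProjBundle B F W) :=
  {p | p.base ∈ (chartAt B i.1).source ∧ p.base ∈ (trivializationAt F W i.1).baseSet ∧
    homCoord F W i p.base p.line.rep ≠ 0}

variable {B F W}

/-- The line over `x` with affine coordinates `z` where the homogeneous coordinate `i` does not vanish. -/
def affinePoint (i : X × Fin (Module.finrank ℂ F)) (x : X)
    (z : Fin (Module.finrank ℂ F - 1) → ℂ) : ProjBundle B F W :=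
  ⟨x, Projectivization.mk ℂ (localVec i.1 x (affineVec i.2 z))
    (localVec_ne_zero _ _ (affineVec_ne_zero _ _))⟩

theorem homCoord_rep_mk (x : X) (w : W x) (hw : w ≠ 0) :
    ∃ t : ℂ, t ≠ 0 ∧ ∀ i, homCoord F W i x (Projectivization.mk ℂ w hw).rep
      = t * homCoord F W i x w := by
  obtain ⟨t, ht⟩ := Projectivization.exists_smul_eq_mk_rep ℂ w hw
  refine ⟨t, t.ne_zero, fun i => ?_⟩
  rw [← ht]
  simp [Units.smul_def]

theorem mem_domain_mk (i : X × Fin (Module.finrank ℂ F)) (x : X) (w : W x) (hw : w ≠ 0) :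
    (⟨x, Projectivization.mk ℂ w hw⟩ : ProjBundle B F W) ∈ domain B F W i ↔
      x ∈ (chartAt B i.1).source ∧ x ∈ (trivializationAt F W i.1).baseSet ∧
        homCoord F W i x w ≠ 0 := by
  obtain ⟨t, ht, h⟩ := homCoord_rep_mk (F := F) x w hw
  simp [domain, h, ht]

theorem coordRatio_mk (i j : X × Fin (Module.finrank ℂ F)) (x : X) (w : W x) (hw : w ≠ 0) :
    coordRatio B F W i j ⟨x, Projectivization.mk ℂ w hw⟩ =
      homCoord F W i x w / homCoord F W j x w := by
  obtain ⟨t, ht, h⟩ := homCoord_rep_mk (F := F) x w hw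
  simp [coordRatio, h, mul_div_mul_left _ _ ht]

variable (B F W)

/-- The standard affine charts of `ℙ W`: a chart of `X`, and the quotients of the other homogeneous
coordinates by the coordinate `i`. -/
def chart (i : X × Fin (Module.finrank ℂ F)) :
    PartialEquiv (ProjBundle B F W) (B × (Fin (Module.finrank ℂ F - 1) → ℂ)) where
  toFun p := (chartAt B i.1 p.base, fun j => coordRatio B F W (i.1, otherIndex i.2 j) i p)
  invFun q := affinePoint i ((chartAt B i.1).symm q.1) q.2
  source := domain B F W i
  target := {q | q.1 ∈ (chartAt B i.1).target ∧
    (chartAt B i.1).symm q.1 ∈ (trivializationAt F W i.1).baseSet}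
  map_source' p hp := ⟨(chartAt B i.1).map_source hp.1, by
    rw [(chartAt B i.1).left_inv hp.1]; exact hp.2.1⟩
  map_target' q hq := by
    rw [affinePoint, mem_domain_mk]
    refine ⟨(chartAt B i.1).map_target hq.1, hq.2, ?_⟩
    simp only [homCoord, LinearMap.comp_apply, linearMapAt_localVec hq.2, affineVec_coord_self]
    exact one_ne_zero
  left_inv' p hp := by
    rw [(chartAt B i.1).left_inv hp.1]
    obtain ⟨x, ℓ⟩ := p
    induction ℓ with
    | h w hw =>
      rw [mem_domain_mk] at hp
      obtain ⟨-, hx, hne⟩ := hp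
      simp only [coordRatio_mk, affinePoint]
      congr 1
      rw [Projectivization.mk_eq_mk_iff']
      refine ⟨(homCoord F W i x w)⁻¹, ?_⟩
      rw [inv_smul_eq_iff₀ hne]
      have h := eq_smul_affineVec i.2 ((trivializationAt F W i.1).linearMapAt ℂ x w) hne
      have h2 := congrArg (fun f => (localVec i.1 x f : W x)) h
      simp only [localVec_linearMapAt hx] at h2
      refine h2.trans ?_
      rw [localVec, if_pos hx, localVec, if_pos hx]
      exact map_smul ((trivializationAt F W i.1).symmₗ ℂ x) _ _
  right_inv' q hq := by
    refine Prod.ext ((chartAt B i.1).right_inv hq.1) (funext fun j => ?_)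
    simp only [affinePoint, coordRatio_mk, homCoord, LinearMap.comp_apply,
      linearMapAt_localVec hq.2, affineVec_coord_self, affineVec_coord_other, div_one]

/-- The overlap of two charts of `X` and two trivializations, seen in the chart `i`. -/
def transDomain (i j : X × Fin (Module.finrank ℂ F)) :
    Set (B × (Fin (Module.finrank ℂ F - 1) → ℂ)) :=
  {q | q.1 ∈ (chartAt B i.1).target ∧ (chartAt B i.1).symm q.1 ∈ (chartAt B j.1).source ∩
    ((trivializationAt F W i.1).baseSet ∩ (trivializationAt F W j.1).baseSet)}

theorem isOpen_transDomain (i j : X × Fin (Module.finrank ℂ F)) :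
    IsOpen (transDomain B F W i j) := by
  have h : IsOpen ((chartAt B i.1).target ∩ (chartAt B i.1).symm ⁻¹' ((chartAt B j.1).source ∩
    ((trivializationAt F W i.1).baseSet ∩ (trivializationAt F W j.1).baseSet))) :=
    (chartAt B i.1).isOpen_inter_preimage_symm ((chartAt B j.1).open_source.inter
      ((trivializationAt F W i.1).open_baseSet.inter (trivializationAt F W j.1).open_baseSet))
  exact h.preimage continuous_fst

/-- A homogeneous coordinate of another trivialization, expressed in the chart `i` of `ℙ W`. -/
def transCoord (x₁ : X) (c : Fin (Module.finrank ℂ F)) (i : X × Fin (Module.finrank ℂ F))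
    (q : B × (Fin (Module.finrank ℂ F - 1) → ℂ)) : ℂ :=
  (Module.finBasis ℂ F).coord c
    ((trivializationAt F W i.1).coordChangeL ℂ (trivializationAt F W x₁)
      ((chartAt B i.1).symm q.1) (affineVec i.2 q.2))

variable {B F W} in
theorem homCoord_localVec {i j : X × Fin (Module.finrank ℂ F)} (c : Fin (Module.finrank ℂ F))
    {q : B × (Fin (Module.finrank ℂ F - 1) → ℂ)} (hq : q ∈ transDomain B F W i j) :
    homCoord F W (j.1, c) ((chartAt B i.1).symm q.1)
      (localVec i.1 ((chartAt B i.1).symm q.1) (affineVec i.2 q.2)) =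
      transCoord B F W j.1 c i q := by
  simp only [homCoord, LinearMap.comp_apply, transCoord, linearMapAt_localVec' hq.2.2.1 hq.2.2.2]

theorem trans_source (i j : X × Fin (Module.finrank ℂ F)) :
    ((chart B F W i).symm.trans (chart B F W j)).source =
      transDomain B F W i j ∩ transCoord B F W j.1 j.2 i ⁻¹' {0}ᶜ := by
  ext q
  simp only [PartialEquiv.trans_source, PartialEquiv.symm_source, Set.mem_inter_iff,
    Set.mem_preimage, Set.mem_compl_iff, Set.mem_singleton_iff]
  have e : (chart B F W i).symm q = affinePoint i ((chartAt B i.1).symm q.1) q.2 := rfl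
  have e2 : (chart B F W j).source = domain B F W j := rfl
  rw [e, e2, affinePoint, mem_domain_mk]
  constructor
  · rintro ⟨h1, h2, h3, h4⟩
    have hq : q ∈ transDomain B F W i j := ⟨h1.1, h2, h1.2, h3⟩
    exact ⟨hq, by rw [← homCoord_localVec j.2 hq]; exact h4⟩
  · rintro ⟨hq, h⟩
    exact ⟨⟨hq.1, hq.2.2.1⟩, hq.2.1, hq.2.2.2, by rw [← homCoord_localVec j.2 hq] at h; exact h⟩

theorem exists_mem_domain (p : ProjBundle B F W) : ∃ a, p ∈ domain B F W (p.base, a) := by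
  have hx := mem_baseSet_trivializationAt F W p.base
  by_contra! h
  have h0 : ∀ a, homCoord F W (p.base, a) p.base p.line.rep = 0 := fun a => by
    by_contra hne
    exact h a ⟨mem_chart_source B p.base, hx, hne⟩
  have h1 : (trivializationAt F W p.base).linearMapAt ℂ p.base p.line.rep = 0 :=
    (Module.finBasis ℂ F).ext_elem fun a => by simpa [homCoord] using h0 a
  apply p.line.rep_nonzero
  rw [← localVec_linearMapAt hx p.line.rep, h1, localVec, if_pos hx]
  exact map_zero ((trivializationAt F W p.base).symmₗ ℂ p.base)

variable {B F W} in
/-- A chart around `p`. -/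
def indexAt (p : ProjBundle B F W) : X × Fin (Module.finrank ℂ F) :=
  (p.base, (exists_mem_domain B F W p).choose)

theorem mem_domain_indexAt (p : ProjBundle B F W) : p ∈ domain B F W (indexAt p) :=
  (exists_mem_domain B F W p).choose_spec

variable [IsManifold 𝓘(ℂ, B) ω X] [ContMDiffVectorBundle ω F W 𝓘(ℂ, B)]

theorem contDiffOn_transCoord (c : Fin (Module.finrank ℂ F)) (i j : X × Fin (Module.finrank ℂ F)) :
    ContDiffOn ℂ ω (transCoord B F W j.1 c i) (transDomain B F W i j) := by
  have h1 : ContMDiffOn 𝓘(ℂ, B) 𝓘(ℂ, F →L[ℂ] F) ω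
      (fun x : X => ((trivializationAt F W i.1).coordChangeL ℂ (trivializationAt F W j.1) x :
        F →L[ℂ] F))
      ((trivializationAt F W i.1).baseSet ∩ (trivializationAt F W j.1).baseSet) :=
    contMDiffOn_coordChangeL _ _
  have h2 : ContMDiffOn 𝓘(ℂ, B) 𝓘(ℂ, B) ω (chartAt B i.1).symm (chartAt B i.1).target :=
    contMDiffOn_chart_symm
  have h3 := (h1.comp' h2).contDiffOn
  have h4 := h3.comp (contDiff_fst (E := B) (F := Fin (Module.finrank ℂ F - 1) → ℂ)).contDiffOn
    (s := transDomain B F W i j) (fun q hq => ⟨hq.1, hq.2.2⟩)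
  have h5 := h4.clm_apply ((contDiff_affineVec (F := F) i.2).comp
    (contDiff_snd (E := B) (F := Fin (Module.finrank ℂ F - 1) → ℂ))).contDiffOn
  exact ((Module.finBasis ℂ F).coord c).toContinuousLinearMap.contDiff.comp_contDiffOn h5

theorem isOpen_trans_source (i j : X × Fin (Module.finrank ℂ F)) :
    IsOpen ((chart B F W i).symm.trans (chart B F W j)).source := by
  rw [trans_source]
  exact (contDiffOn_transCoord B F W j.2 i j).continuousOn.isOpen_inter_preimage
    (isOpen_transDomain B F W i j) isOpen_compl_singleton

theorem contDiffOn_trans (i j : X × Fin (Module.finrank ℂ F)) :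
    ContDiffOn ℂ ω ((chart B F W i).symm.trans (chart B F W j))
      ((chart B F W i).symm.trans (chart B F W j)).source := by
  rw [trans_source]
  have hB : ContDiffOn ℂ ω (fun q : B × (Fin (Module.finrank ℂ F - 1) → ℂ) =>
      chartAt B j.1 ((chartAt B i.1).symm q.1)) (transDomain B F W i j) := by
    have h1 : ContMDiffOn 𝓘(ℂ, B) 𝓘(ℂ, B) ω (chartAt B j.1) (chartAt B j.1).source :=
      contMDiffOn_chart
    have h2 : ContMDiffOn 𝓘(ℂ, B) 𝓘(ℂ, B) ω (chartAt B i.1).symm (chartAt B i.1).target :=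
      contMDiffOn_chart_symm
    exact (h1.comp' h2).contDiffOn.comp contDiff_fst.contDiffOn (fun q hq => ⟨hq.1, hq.2.1⟩)
  have hF : ContDiffOn ℂ ω (fun q : B × (Fin (Module.finrank ℂ F - 1) → ℂ) =>
      fun l => transCoord B F W j.1 (otherIndex j.2 l) i q / transCoord B F W j.1 j.2 i q)
      (transDomain B F W i j ∩ transCoord B F W j.1 j.2 i ⁻¹' {0}ᶜ) := by
    rw [contDiffOn_pi]
    intro l
    exact ((contDiffOn_transCoord B F W _ i j).mono Set.inter_subset_left).div
      ((contDiffOn_transCoord B F W _ i j).mono Set.inter_subset_left) (fun q hq => hq.2)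
  refine ((hB.mono Set.inter_subset_left).prodMk hF).congr fun q hq => ?_
  refine Prod.ext rfl (funext fun l => ?_)
  change coordRatio B F W _ _ (affinePoint i ((chartAt B i.1).symm q.1) q.2) = _
  rw [affinePoint, coordRatio_mk, homCoord_localVec _ hq.1, homCoord_localVec (j := j) j.2 hq.1]

/-- The holomorphic atlas of `ℙ W`. -/
def core : ChartedSpaceCore (B × (Fin (Module.finrank ℂ F - 1) → ℂ)) (ProjBundle B F W) where
  atlas := Set.range (chart B F W)
  chartAt p := chart B F W (indexAt p)
  mem_chart_source p := mem_domain_indexAt B F W p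
  chart_mem_atlas p := ⟨_, rfl⟩
  open_source := by
    rintro _ _ ⟨i, rfl⟩ ⟨j, rfl⟩
    exact isOpen_trans_source B F W i j
  continuousOn_toFun := by
    rintro _ _ ⟨i, rfl⟩ ⟨j, rfl⟩
    exact (contDiffOn_trans B F W i j).continuousOn

instance : TopologicalSpace (ProjBundle B F W) := (core B F W).toTopologicalSpace

instance : ChartedSpace (B × (Fin (Module.finrank ℂ F - 1) → ℂ)) (ProjBundle B F W) :=
  (core B F W).toChartedSpace

instance : IsManifold 𝓘(ℂ, B × (Fin (Module.finrank ℂ F - 1) → ℂ)) ω (ProjBundle B F W) := by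
  apply isManifold_of_contDiffOn
  intro e e' he he'
  obtain ⟨_, ⟨i, rfl⟩, rfl⟩ : ∃ c, ∃ h : c ∈ (core B F W).atlas,
    e = (core B F W).openPartialHomeomorph c h := by simpa [atlas, ChartedSpace.atlas] using he
  obtain ⟨_, ⟨j, rfl⟩, rfl⟩ : ∃ c, ∃ h : c ∈ (core B F W).atlas,
    e' = (core B F W).openPartialHomeomorph c h := by simpa [atlas, ChartedSpace.atlas] using he'
  have h := contDiffOn_trans B F W i j
  simp only [modelWithCornersSelf_coe, modelWithCornersSelf_coe_symm, Set.range_id, Set.inter_univ,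
    Set.preimage_id]
  exact h

theorem isOpen_domain (i : X × Fin (Module.finrank ℂ F)) : IsOpen (domain B F W i) :=
  (core B F W).open_source' (e := chart B F W i) ⟨i, rfl⟩

theorem contMDiffOn_chart' (i : X × Fin (Module.finrank ℂ F)) :
    ContMDiffOn 𝓘(ℂ, B × (Fin (Module.finrank ℂ F - 1) → ℂ))
      𝓘(ℂ, B × (Fin (Module.finrank ℂ F - 1) → ℂ)) ω (chart B F W i) (domain B F W i) := by
  have h : (core B F W).openPartialHomeomorph (chart B F W i) ⟨i, rfl⟩ ∈
      atlas (B × (Fin (Module.finrank ℂ F - 1) → ℂ)) (ProjBundle B F W) := by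
    simp only [atlas, ChartedSpace.atlas, Set.mem_iUnion]
    exact ⟨_, _, rfl⟩
  exact contMDiffOn_of_mem_maximalAtlas (IsManifold.subset_maximalAtlas h)

theorem contMDiffOn_coordRatio (i j : X × Fin (Module.finrank ℂ F)) :
    ContMDiffOn 𝓘(ℂ, B × (Fin (Module.finrank ℂ F - 1) → ℂ)) 𝓘(ℂ, ℂ) ω
      (coordRatio B F W i j) (domain B F W i ∩ domain B F W j) := by
  have h1 : ContDiffOn ℂ ω (fun q => (transCoord B F W j.1 j.2 i q)⁻¹)
      ((chart B F W i).symm.trans (chart B F W j)).source := by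
    rw [trans_source]
    exact ((contDiffOn_transCoord B F W _ i j).mono Set.inter_subset_left).inv (fun q hq => hq.2)
  have hmaps : ∀ p ∈ domain B F W i ∩ domain B F W j, chart B F W i p ∈
      ((chart B F W i).symm.trans (chart B F W j)).source := by
    rintro p ⟨hi, hj⟩
    refine ⟨(chart B F W i).map_source hi, ?_⟩
    change (chart B F W i).symm (chart B F W i p) ∈ domain B F W j
    rw [(chart B F W i).left_inv hi]
    exact hj
  refine (h1.contMDiffOn.comp ((contMDiffOn_chart' B F W i).mono Set.inter_subset_left)
    hmaps).congr fun p hp => ?_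
  have hq := hmaps p hp
  rw [trans_source] at hq
  change _ = (transCoord B F W j.1 j.2 i (chart B F W i p))⁻¹
  conv_lhs => rw [← (chart B F W i).left_inv hp.1]
  change coordRatio B F W _ _ (affinePoint i ((chartAt B i.1).symm (chart B F W i p).1)
    (chart B F W i p).2) = _
  rw [affinePoint, coordRatio_mk, homCoord_localVec (j := j) j.2 hq.1]
  simp only [homCoord, LinearMap.comp_apply, linearMapAt_localVec hq.1.2.2.1,
    affineVec_coord_self, one_div]

/-- The line bundle `𝒪(1)` on `ℙ W`, the dual of the tautological line bundle. On the open set `i`, the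
homogeneous coordinate `σ i`, a nonzero linear form on the tautological line, is a frame of `𝒪(1)`. A
linear form `s = sᵢ σ i = sⱼ σ j` on that line has `sⱼ = (σ i / σ j) sᵢ`. -/
def hyperplaneBundle : VectorBundleCore ℂ (ProjBundle B F W) ℂ (X × Fin (Module.finrank ℂ F)) where
  baseSet := domain B F W
  isOpen_baseSet := isOpen_domain B F W
  indexAt := indexAt
  mem_baseSet_at := mem_domain_indexAt B F W
  coordChange i j p := coordRatio B F W i j p • ContinuousLinearMap.id ℂ ℂ
  coordChange_self i p hp v := by
    simp [coordRatio, div_self hp.2.2]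
  continuousOn_coordChange i j :=
    (contMDiffOn_coordRatio B F W i j).continuousOn.smul continuousOn_const
  coordChange_comp i j k p hp v := by
    simp only [coordRatio, _root_.smul_apply, ContinuousLinearMap.id_apply,
      smul_eq_mul]
    have := hp.1.2.2.2
    field_simp

instance : (hyperplaneBundle B F W).IsContMDiff
    𝓘(ℂ, B × (Fin (Module.finrank ℂ F - 1) → ℂ)) ω where
  contMDiffOn_coordChange i j :=
    (contMDiffOn_coordRatio B F W i j).smul contMDiffOn_const

end ProjBundle

end ProjectiveBundle

section BigVectorBundle

/-- A holomorphic vector bundle `V` over `X` is big if the line bundle `𝒪(1)` over the projective bundle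
`ℙ(Vᵛ)` of lines in the dual bundle is big. -/
def IsBigVectorBundle {X : Type*} (B F : Type*) [NormedAddCommGroup B] [NormedSpace ℂ B]
    [NormedAddCommGroup F] [NormedSpace ℂ F] [FiniteDimensional ℂ F]
    [TopologicalSpace X] [ChartedSpace B X] [IsManifold 𝓘(ℂ, B) ω X]
    (V : X → Type*) [∀ x, AddCommGroup (V x)] [∀ x, Module ℂ (V x)] [∀ x, TopologicalSpace (V x)]
    [TopologicalSpace (TotalSpace F V)] [FiberBundle F V] [VectorBundle ℂ F V]
    [ContMDiffVectorBundle ω F V 𝓘(ℂ, B)] : Prop :=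
  IsBigLineBundle (B × (Fin (Module.finrank ℂ (F →L[ℂ] ℂ) - 1) → ℂ))
    (ProjBundle.hyperplaneBundle B (F →L[ℂ] ℂ) (fun x => V x →L[ℂ] Bundle.Trivial X ℂ x))

/-- The holomorphic tangent bundle of the complex manifold `X` (modelled on `B`) is big. -/
def HasBigTangentBundle (B X : Type*) [NormedAddCommGroup B] [NormedSpace ℂ B]
    [FiniteDimensional ℂ B] [TopologicalSpace X] [ChartedSpace B X] [IsManifold 𝓘(ℂ, B) ω X] :
    Prop :=
  have : IsManifold 𝓘(ℂ, B) (ω + 1) X := inferInstanceAs (IsManifold 𝓘(ℂ, B) ω X)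
  IsBigVectorBundle B B (TangentSpace 𝓘(ℂ, B) : X → Type _)

end BigVectorBundle

end

/-! A section of `𝒪(m)` on the projectivized cotangent bundle of `X` is a function on the cotangent
bundle, holomorphic off the zero section and homogeneous of degree `m` on the fibres. Pull it back
to `ℂᵏ × M` and fix a point of a chart of `M` and a covector: what remains is an entire function of
`u ∈ ℂᵏ`. Translating `u` into a compact fundamental domain of `Λ` moves the point and the covector
by some `ρ γ`. These maps lie in a compact set, so Cauchy estimates bound their derivatives
uniformly (`exists_bound_fderiv_autInCharts`). Hence the entire function is bounded, and constant by
Liouville (`ChartBalls.plotEval_eq`). A section is thus determined by its restriction to `{0} × M`.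

With `d = dim M`, this restriction is a homogeneous function of `d` base and `k + d` fibre
variables. Such functions are counted by Siegel's method (`HomogeneousSystem.rank_le`): by the
Schwarz lemma, one that vanishes to order `A m + 1` at finitely many fixed points is zero, so `h⁰ ≤
N (A m + 1) ^ (d + (k + d - 1))`. The projectivized cotangent bundle has dimension `(k + d) + (k + d
- 1)`, which exceeds this exponent by `k > 0`, so the growth required for bigness fails. -/

noncomputable section

/-! ### Taylor polynomials and the dimension of the space they span -/

section TaylorPolynomial

variable {Z : Type*} [NormedAddCommGroup Z] [NormedSpace ℂ Z]

/-- The Taylor polynomial at `0` of order `< n`, as a function. -/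
def taylorPoly (n : ℕ) (G : Z → ℂ) (z : Z) : ℂ :=
  ∑ j ∈ Finset.range n, ((j.factorial : ℂ)⁻¹) * iteratedFDeriv ℂ j G 0 (fun _ => z)

theorem taylorPoly_add (n : ℕ) {G G' : Z → ℂ} (h : ContDiffAt ℂ ω G 0) (h' : ContDiffAt ℂ ω G' 0) :
    taylorPoly n (G + G') = taylorPoly n G + taylorPoly n G' := by
  ext z
  simp only [taylorPoly, Pi.add_apply, ← Finset.sum_add_distrib]
  refine Finset.sum_congr rfl fun j _ => ?_
  rw [iteratedFDeriv_add_apply (h.of_le le_top) (h'.of_le le_top)]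
  simp [mul_add]

theorem taylorPoly_smul (n : ℕ) {G : Z → ℂ} (a : ℂ) (h : ContDiffAt ℂ ω G 0) :
    taylorPoly n (a • G) = a • taylorPoly n G := by
  ext z
  simp only [taylorPoly, Pi.smul_apply, smul_eq_mul, Finset.mul_sum]
  refine Finset.sum_congr rfl fun j _ => ?_
  rw [iteratedFDeriv_const_smul_apply (h.of_le le_top)]
  simp only [smul_apply, smul_eq_mul]
  ring

/-- Regularity `ω` means analytic, so the Taylor polynomial is a partial sum of a convergent power
series and only the remainder is left. -/
theorem isBigO_of_taylorPoly_eq_zero {n : ℕ} {G : Z → ℂ} (h : ContDiffAt ℂ ω G 0)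
    (h0 : taylorPoly n G = 0) : G =O[𝓝 0] fun z => ‖z‖ ^ n := by
  obtain ⟨p, hp⟩ := h.analyticAt
  have h1 := hp.isBigO_sub_partialSum_pow n
  obtain ⟨r, hr⟩ := hp
  have h2 : ∀ z, p.partialSum n z = 0 := fun z => by
    refine Eq.trans ?_ (congrFun h0 z)
    simp only [FormalMultilinearSeries.partialSum, taylorPoly]
    refine Finset.sum_congr rfl fun j _ => ?_
    rw [← hr.factorial_smul z j, nsmul_eq_mul, ← mul_assoc,
      inv_mul_cancel₀ (Nat.cast_ne_zero.2 j.factorial_ne_zero), one_mul]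
  simpa [h2] using h1

/-- The monomial functions with all exponents `< n`. -/
def monomials {D : ℕ} (b : Module.Basis (Fin D) ℂ Z) (n : ℕ) : Finset (Z → ℂ) :=
  @Finset.image _ _ (Classical.decEq _) (fun (α : Fin D → Fin n) z => ∏ a, b.repr z a ^ (α a : ℕ))
    Finset.univ

/-- The box of exponents is larger than the simplex of total degree `< n`, but it has the same order
of growth in `n`, which suffices for the count. -/
theorem card_monomials_le {D : ℕ} (b : Module.Basis (Fin D) ℂ Z) (n : ℕ) :
    (monomials b n).card ≤ n ^ D :=
  (@Finset.card_image_le _ _ _ _ (Classical.decEq _)).trans (by simp)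

/-- Expanding `z` in the basis gives products of `j` coordinates. The exponent of coordinate `a` is
the number of slots `i` with `r i = a`, at most `j < n`. -/
theorem multilinear_diag_mem_span {D : ℕ} (b : Module.Basis (Fin D) ℂ Z) {n j : ℕ} (hj : j < n)
    (f : MultilinearMap ℂ (fun _ : Fin j => Z) ℂ) :
    (fun z => f fun _ => z) ∈ Submodule.span ℂ (monomials b n : Set (Z → ℂ)) := by
  classical
  have h : (fun z => f fun _ => z) = ∑ r : Fin j → Fin D,
      (f fun i => b (r i)) • fun z => ∏ i, b.repr z (r i) := by
    ext z
    have h1 : (fun _ : Fin j => z) = fun _ => ∑ a, b.repr z a • b a := by simp [b.sum_repr]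
    rw [h1, f.map_sum, Finset.sum_apply]
    refine Finset.sum_congr rfl fun r _ => ?_
    rw [f.map_smul_univ]
    simp [mul_comm]
  rw [h]
  refine Submodule.sum_mem _ fun r _ => Submodule.smul_mem _ _ (Submodule.subset_span ?_)
  simp only [monomials, Finset.coe_image, Finset.coe_univ, Set.image_univ, Set.mem_range]
  refine ⟨fun a => ⟨(Finset.univ.filter fun i => r i = a).card,
    ((Finset.card_le_univ _).trans_eq (by simp)).trans_lt hj⟩, ?_⟩
  ext z
  rw [← Finset.prod_fiberwise' _ r]
  simp

theorem taylorPoly_mem_span {D : ℕ} (b : Module.Basis (Fin D) ℂ Z) (n : ℕ) (G : Z → ℂ) :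
    taylorPoly n G ∈ Submodule.span ℂ (monomials b n : Set (Z → ℂ)) := by
  have h : taylorPoly n G = ∑ j ∈ Finset.range n,
      ((j.factorial : ℂ)⁻¹) • fun z => iteratedFDeriv ℂ j G 0 fun _ => z := by
    ext z
    simp [taylorPoly]
  rw [h]
  exact Submodule.sum_mem _ fun j hj => Submodule.smul_mem _ _
    (multilinear_diag_mem_span b (Finset.mem_range.1 hj) (iteratedFDeriv ℂ j G 0).toMultilinearMap)

/-- If the Taylor polynomials of order `< n` of finitely many germs determine the elements of a vector
space, then its dimension is bounded accordingly. -/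
theorem rank_le_of_taylorPoly [FiniteDimensional ℂ Z] {V ι : Type*} [AddCommGroup V] [Module ℂ V]
    [Fintype ι] (G : ι → V →ₗ[ℂ] (Z → ℂ)) (hG : ∀ i s, ContDiffAt ℂ ω (G i s) 0) (n : ℕ)
    (hinj : ∀ s, (∀ i, taylorPoly n (G i s) = 0) → s = 0) :
    Cardinal.toENat (Module.rank ℂ V) ≤
      ((Fintype.card ι * n ^ Module.finrank ℂ Z : ℕ) : ℕ∞) := by
  let b := Module.finBasis ℂ Z
  let W := Submodule.span ℂ (monomials b n : Set (Z → ℂ))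
  let Φ : V →ₗ[ℂ] (ι → W) :=
    { toFun s i := ⟨taylorPoly n (G i s), taylorPoly_mem_span b n _⟩
      map_add' s t := by
        ext1 i; ext1
        simp only [map_add, Pi.add_apply, Submodule.coe_add]
        exact taylorPoly_add n (hG i s) (hG i t)
      map_smul' a s := by
        ext1 i; ext1
        simp only [map_smul, Pi.smul_apply, Submodule.coe_smul, RingHom.id_apply]
        exact taylorPoly_smul n a (hG i s) }
  have hΦ : Function.Injective Φ := by
    rw [← LinearMap.ker_eq_bot, LinearMap.ker_eq_bot']
    exact fun s hs => hinj s fun i => congrArg Subtype.val (congrFun hs i)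
  have : FiniteDimensional ℂ W := FiniteDimensional.span_finset ℂ _
  -- Finiteness has to come first: `toENat` of an infinite rank is `⊤`.
  have : FiniteDimensional ℂ V := Module.Finite.of_injective Φ hΦ
  rw [← Module.finrank_eq_rank]
  simp only [map_natCast, Nat.cast_le]
  refine (LinearMap.finrank_le_finrank_of_injective hΦ).trans ?_
  rw [Module.finrank_pi_fintype]
  simp only [Finset.sum_const, Finset.card_univ, smul_eq_mul]
  exact Nat.mul_le_mul_left _
    ((finrank_span_finset_le_card _).trans (card_monomials_le b n))

end TaylorPolynomial

/-! ### Schwarz lemma and maximum principle for homogeneous functions -/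

section SchwarzLemma

/-- A holomorphic function on the disc of radius `2` that vanishes to order `n + 1` at `0`. -/
theorem norm_apply_one_le_of_isBigO {g : ℂ → ℂ} {S : ℝ} {n : ℕ}
    (hd : DifferentiableOn ℂ g (Metric.ball 0 2)) (hb : ∀ t ∈ Metric.ball (0 : ℂ) 2, ‖g t‖ ≤ S)
    (h0 : g =O[𝓝 0] fun t => ‖t‖ ^ (n + 1)) : ‖g 1‖ ≤ S * (1 / 2) ^ (n + 1) := by
  have hg0 : g 0 = 0 := by simpa using h0.eq_zero_imp.self_of_nhds
  -- The Schwarz lemma with exponent `n + 1` asks for `o(‖t‖ ^ n)`, which `O(‖t‖ ^ (n + 1))`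
  -- implies.
  have h1 : g =o[𝓝 0] fun t => ‖t‖ ^ n := h0.trans_isLittleO 
    ((Asymptotics.isLittleO_pow_pow (𝕜 := ℝ) (Nat.lt_succ_self n)).comp_tendsto
      (continuous_norm.tendsto' (0 : ℂ) 0 norm_zero))
  have := Complex.dist_le_mul_div_pow_of_mapsTo_ball_of_isLittleO (z := 1) (n := n) hd
    (fun t ht => by simpa [hg0] using hb t ht) (by simpa [hg0] using h1) (by simp)
  simpa [hg0] using this

variable {Ψ : Type*} [NormedAddCommGroup Ψ] [NormedSpace ℂ Ψ]

theorem norm_le_mul_pow_of_homogeneous {Φ : Ψ → ℂ} {m : ℕ} {S : ℝ}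
    (hom : ∀ (t : ℂ) f, t ≠ 0 → Φ (t • f) = t ^ m * Φ f) (h0 : Φ 0 = 0) (hS : 0 ≤ S)
    (hb : ∀ f, ‖f‖ = 1 → ‖Φ f‖ ≤ S) (f : Ψ) : ‖Φ f‖ ≤ S * ‖f‖ ^ m := by
  rcases eq_or_ne f 0 with rfl | hf
  · rw [h0, norm_zero]; positivity
  · have hn : (‖f‖ : ℂ) ≠ 0 := by simpa using hf
    have h1 : f = (‖f‖ : ℂ) • ((‖f‖ : ℂ)⁻¹ • f) := by rw [smul_inv_smul₀ hn]
    rw [h1, hom _ _ hn, norm_mul, norm_pow, ← h1, mul_comm]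
    simp only [Complex.norm_real, norm_norm]
    gcongr
    exact hb _ (by simp [norm_smul, hf])

/-- A homogeneous function is controlled by its restriction to an affine hyperplane, by the maximum
principle. -/
theorem norm_le_of_hyperplane_bound {Φ : Ψ → ℂ} {m : ℕ} {S : ℝ}
    (hom : ∀ (t : ℂ) f, t ≠ 0 → Φ (t • f) = t ^ m * Φ f) (h0 : Φ 0 = 0)
    (hd : ∀ f, f ≠ 0 → DifferentiableAt ℂ Φ f)
    {f₀ : Ψ} {e : Ψ →L[ℂ] ℂ} (he : e f₀ = 1) (hf₀ : ‖f₀‖ ≤ 1) (he' : ‖e‖ ≤ 1)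
    (hb : ∀ h, e h = 0 → ‖h‖ ≤ 1 → ‖Φ (f₀ + h)‖ ≤ S) (f : Ψ) :
    ‖Φ f‖ ≤ 2 ^ m * S * ‖f‖ ^ m := by
  have hS : 0 ≤ S := (norm_nonneg _).trans (hb 0 (map_zero e) (by simp))
  refine norm_le_mul_pow_of_homogeneous hom h0 (by positivity) (fun f hf => ?_) f
  have ht : ‖e f‖ ≤ 1 := (e.le_opNorm f).trans (by rw [hf, mul_one]; exact he')
  obtain ⟨h, hh⟩ : ∃ h, h = f - e f • f₀ := ⟨_, rfl⟩
  have heh : e h = 0 := by simp [hh, he]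
  have hh2 : ‖h‖ ≤ 2 := by
    rw [hh]
    refine (norm_sub_le _ _).trans ?_
    rw [norm_smul, hf]
    nlinarith [norm_nonneg (e f), norm_nonneg f₀]
  have hf' : f = e f • f₀ + h := by rw [hh]; abel
  rcases eq_or_ne h 0 with hz | hz
  · rw [hz, add_zero] at hf'
    rcases eq_or_ne (e f) 0 with h1 | h1
    · rw [hf', h1, zero_smul, h0, norm_zero]; positivity
    · rw [hf', hom _ _ h1, norm_mul, norm_pow]
      have := hb 0 (map_zero e) (by simp)
      rw [add_zero] at this
      have h2 : ‖e f‖ ^ m ≤ 2 ^ m := by gcongr; linarith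
      gcongr
  -- For `h ≠ 0` in the kernel of `e`, the line `s • f₀ + h` misses `0`, so `Φ` is entire along it.
  -- On `‖s‖ = 2` homogeneity gives `s ^ m * Φ (f₀ + s⁻¹ • h)` with `‖s⁻¹ • h‖ ≤ 1`, where `hb`
  -- applies. The maximum principle carries the bound to `s = e f`, even if `e f = 0`.
  · have hne : ∀ s : ℂ, s • f₀ + h ≠ 0 := fun s hs => by
      have h1 := congrArg e hs
      simp only [map_add, map_smul, he, heh, map_zero, smul_eq_mul, mul_one, add_zero] at h1
      rw [h1, zero_smul, zero_add] at hs
      exact hz hs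
    have hdiff : Differentiable ℂ fun s : ℂ => Φ (s • f₀ + h) := fun s =>
      (hd _ (hne s)).comp s (by fun_prop)
    rw [hf']
    refine Complex.norm_le_of_forall_mem_frontier_norm_le (f := fun s : ℂ => Φ (s • f₀ + h))
      (U := Metric.ball 0 2) Metric.isBounded_ball hdiff.diffContOnCl (fun s hs => ?_)
      (subset_closure (by simp; linarith))
    rw [frontier_ball _ two_ne_zero, mem_sphere_zero_iff_norm] at hs
    have hs0 : s ≠ 0 := by rintro rfl; simp at hs
    have h1 : s • f₀ + h = s • (f₀ + s⁻¹ • h) := by rw [smul_add, smul_inv_smul₀ hs0]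
    simp only [h1]
    rw [hom _ _ hs0, norm_mul, norm_pow, hs]
    gcongr
    refine hb _ (by simp [heh]) ?_
    rw [norm_smul, norm_inv, hs]
    linarith

end SchwarzLemma

/-! ### Siegel's bound for the dimension of a space of homogeneous functions -/

section RankBound

variable {V ι E Ψ : Type*} [AddCommGroup V] [Module ℂ V] [Fintype ι]
  [NormedAddCommGroup E] [NormedSpace ℂ E] [FiniteDimensional ℂ E]
  [NormedAddCommGroup Ψ] [NormedSpace ℂ Ψ] [FiniteDimensional ℂ Ψ]

/-- A vector space of families of local functions, holomorphic in the base and homogeneous of degree `m` in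
the fibre off the zero section, on finitely many balls whose halves control each other. -/
structure HomogeneousSystem (F : ι → V →ₗ[ℂ] (E → Ψ → ℂ)) (c : ι → E) (r : ι → ℝ) (C : ℝ)
    (m : ℕ) : Prop where
  radius_pos : ∀ i, 0 < r i
  contDiffAt : ∀ i s, ∀ x ∈ Metric.closedBall (c i) (r i), ∀ f ≠ 0,
    ContDiffAt ℂ ω (fun q : E × Ψ => F i s q.1 q.2) (x, f)
  homogeneous : ∀ i s x (t : ℂ) f, t ≠ 0 → F i s x (t • f) = t ^ m * F i s x f
  apply_zero : ∀ i s x, F i s x 0 = 0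
  exchange : ∀ i, ∀ x ∈ Metric.closedBall (c i) (r i), ∃ j, ∃ y ∈ Metric.ball (c j) (r j / 2),
    ∃ T : Ψ → Ψ, (∀ f, ‖T f‖ ≤ C * ‖f‖) ∧ ∀ s f, F i s x f = F j s y (T f)
  ext : ∀ s, (∀ i, ∀ x ∈ Metric.closedBall (c i) (r i), ∀ f, F i s x f = 0) → s = 0

namespace HomogeneousSystem

variable {F : ι → V →ₗ[ℂ] (E → Ψ → ℂ)} {c : ι → E} {r : ι → ℝ} {C : ℝ} {m : ℕ}

/-- Compactness of the balls and of the unit sphere. The size of `S` is irrelevant: it only starts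
an iteration that contracts to `0`. -/
theorem exists_bound (hF : HomogeneousSystem F c r C m) (s : V) :
    ∃ S, 0 ≤ S ∧ ∀ i, ∀ x ∈ Metric.closedBall (c i) (r i), ∀ f, ‖F i s x f‖ ≤ S * ‖f‖ ^ m := by
  have h : ∀ i, ∃ S, ∀ q ∈ Metric.closedBall (c i) (r i) ×ˢ Metric.sphere (0 : Ψ) 1,
      ‖F i s q.1 q.2‖ ≤ S := fun i => by
    have := FiniteDimensional.proper ℂ E
    have := FiniteDimensional.proper ℂ Ψ
    refine ((isCompact_closedBall _ _).prod (isCompact_sphere _ _)).exists_bound_of_continuousOn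
      fun q hq => ?_
    exact (hF.contDiffAt i s q.1 hq.1 q.2
      (fun h => by simpa [h] using hq.2)).continuousAt.continuousWithinAt
  choose S hS using h
  refine ⟨∑ i, |S i|, by positivity, fun i x hx f => ?_⟩
  refine norm_le_mul_pow_of_homogeneous (fun t f => hF.homogeneous i s x t f) (hF.apply_zero i s x)
    (by positivity) (fun f hf => ?_) f
  exact (hS i (x, f) ⟨hx, by simpa using hf⟩).trans ((le_abs_self _).trans
    (Finset.single_le_sum (f := fun i => |S i|) (fun _ _ => abs_nonneg _) (Finset.mem_univ i)))

variable {f₀ : Ψ} {e : Ψ →L[ℂ] ℂ}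

/-- The restriction to an affine hyperplane of the fibre, centred. -/
def restr (F : ι → V →ₗ[ℂ] (E → Ψ → ℂ)) (c : ι → E) (f₀ : Ψ) (e : Ψ →L[ℂ] ℂ) (i : ι) :
    V →ₗ[ℂ] (E × LinearMap.ker e.toLinearMap → ℂ) where
  toFun s z := F i s (c i + z.1) (f₀ + z.2)
  map_add' s t := by ext; simp
  map_smul' a s := by ext; simp

/-- The hyperplane `e = 1` avoids the zero section, so restrictions to it are holomorphic everywhere
over the balls. -/
theorem add_mem_ker_ne_zero (he : e f₀ = 1) {h : Ψ} (hh : e h = 0) : f₀ + h ≠ 0 := fun h0 => by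
  have := congrArg e h0
  simp [he, hh] at this

theorem contDiffAt_restr (hF : HomogeneousSystem F c r C m) (he : e f₀ = 1) (i : ι) (s : V)
    {z : E × LinearMap.ker e.toLinearMap} (hz : c i + z.1 ∈ Metric.closedBall (c i) (r i)) :
    ContDiffAt ℂ ω (restr F c f₀ e i s) z := by
  have h1 := hF.contDiffAt i s (c i + z.1) hz (f₀ + z.2) (add_mem_ker_ne_zero he z.2.2)
  have h2 : ContDiffAt ℂ ω (fun z : E × LinearMap.ker e.toLinearMap =>
      ((c i + z.1, f₀ + (LinearMap.ker e.toLinearMap).subtypeL z.2) : E × Ψ)) z := by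
    fun_prop
  exact ContDiffAt.comp (g := fun q : E × Ψ => F i s q.1 q.2) z h1 h2

/-- One round of the contraction. The Schwarz lemma at `(c j, f₀)` gives `3 ^ m * (1 / 2) ^ (n +
1)`, where `3` bounds `‖f₀ + t • h‖` for `‖t‖ < 2`. Passing from the hyperplane to all of the fibre
costs `2 ^ m`, and the exchange of balls costs `C ^ m`. -/
theorem bound_improve (hF : HomogeneousSystem F c r C m) (he : e f₀ = 1)
    (hf₀ : ‖f₀‖ ≤ 1) (he' : ‖e‖ ≤ 1) {n : ℕ} (s : V)
    (hs : ∀ i, taylorPoly (n + 1) (restr F c f₀ e i s) = 0) {S : ℝ} (hS0 : 0 ≤ S)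
    (hS : ∀ i, ∀ x ∈ Metric.closedBall (c i) (r i), ∀ f, ‖F i s x f‖ ≤ S * ‖f‖ ^ m) :
    ∀ i, ∀ x ∈ Metric.closedBall (c i) (r i), ∀ f,
      ‖F i s x f‖ ≤ (S * ((6 * C) ^ m * (1 / 2) ^ (n + 1))) * ‖f‖ ^ m := by
  intro i x hx f
  obtain ⟨j, y, hy, T, hT, hFT⟩ := hF.exchange i x hx
  have hr := hF.radius_pos j
  rw [hFT]
  -- Since `y` lies in the half ball, the disc through `c j` and `y` extends to parameter radius `2`
  -- inside the full ball; this is the radius in the Schwarz lemma.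
  have hmem : ∀ t : ℂ, ‖t‖ < 2 → c j + t • (y - c j) ∈ Metric.closedBall (c j) (r j) := by
    intro t ht
    rw [Metric.mem_ball, dist_eq_norm] at hy
    simp only [Metric.mem_closedBall, dist_self_add_left, norm_smul]
    nlinarith [norm_nonneg t, norm_nonneg (y - c j)]
  have key : ∀ h, e h = 0 → ‖h‖ ≤ 1 →
      ‖F j s y (f₀ + h)‖ ≤ S * 3 ^ m * (1 / 2) ^ (n + 1) := by
    intro h hh hh1
    let z : E × LinearMap.ker e.toLinearMap := (y - c j, ⟨h, hh⟩)
    have hO := isBigO_of_taylorPoly_eq_zero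
      (contDiffAt_restr hF he j s (z := 0) (by simpa using hr.le)) (hs j)
    have h1 : ‖restr F c f₀ e j s ((1 : ℂ) • z)‖ ≤ S * 3 ^ m * (1 / 2) ^ (n + 1) := by
      refine norm_apply_one_le_of_isBigO (g := fun t : ℂ => restr F c f₀ e j s (t • z)) ?_ ?_ ?_
      · intro t ht
        have h2 : ContDiffAt ℂ ω (restr F c f₀ e j s) (t • z) :=
          contDiffAt_restr hF he j s (hmem t (by simpa using ht))
        exact ((h2.differentiableAt (by simp)).comp t (by fun_prop)).differentiableWithinAt
      · intro t ht
        have ht' : ‖t‖ < 2 := by simpa using ht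
        refine (hS j _ (hmem t ht') _).trans ?_
        gcongr
        refine (norm_add_le _ _).trans ?_
        have : ‖t • h‖ ≤ 2 := by
          rw [norm_smul]; nlinarith [norm_nonneg t, norm_nonneg h]
        change ‖f₀‖ + ‖t • h‖ ≤ 3
        linarith
      · have h3 : Filter.Tendsto (fun t : ℂ => t • z) (𝓝 0) (𝓝 0) := by
          have : Continuous fun t : ℂ => t • z := by fun_prop
          simpa using this.tendsto 0
        refine (hO.comp_tendsto h3).trans ?_
        refine Asymptotics.IsBigO.of_bound (‖z‖ ^ (n + 1)) (Filter.Eventually.of_forall fun t => ?_)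
        simp [norm_smul, mul_pow, mul_comm]
    rw [one_smul] at h1
    simpa [restr, z] using h1
  have h4 := norm_le_of_hyperplane_bound (Φ := F j s y) (m := m)
    (fun t f => hF.homogeneous j s y t f) (hF.apply_zero j s y) (fun f hf => by
      have h5 := hF.contDiffAt j s y
        (Metric.ball_subset_closedBall (Metric.ball_subset_ball (by linarith) hy)) f hf
      exact (h5.differentiableAt (by simp)).comp (f := fun f => (y, f)) f (by fun_prop))
    he hf₀ he' key (T f)
  refine h4.trans ?_
  calc 2 ^ m * (S * 3 ^ m * (1 / 2) ^ (n + 1)) * ‖T f‖ ^ m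
      ≤ 2 ^ m * (S * 3 ^ m * (1 / 2) ^ (n + 1)) * (C * ‖f‖) ^ m := by
        gcongr; exact hT f
    _ = _ := by
        rw [mul_pow C, mul_pow 6 C, show (6 : ℝ) = 2 * 3 by norm_num, mul_pow 2 3]; ring

/-- A Taylor polynomial of length proportional to `m`, taken on the hyperplane at each centre,
determines the element. The hyperplane removes the one fibre dimension that homogeneity makes
redundant. -/
theorem rank_le (hF : HomogeneousSystem F c r C m) (hC : 0 ≤ C) (he : e f₀ = 1)
    (hf₀ : ‖f₀‖ ≤ 1) (he' : ‖e‖ ≤ 1) {A : ℕ} (hA : 6 * C ≤ 2 ^ A) :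
    Cardinal.toENat (Module.rank ℂ V) ≤ ((Fintype.card ι *
      (A * m + 1) ^ (Module.finrank ℂ E + (Module.finrank ℂ Ψ - 1)) : ℕ) : ℕ∞) := by
  have hdim : Module.finrank ℂ (E × LinearMap.ker e.toLinearMap) =
      Module.finrank ℂ E + (Module.finrank ℂ Ψ - 1) := by
    rw [Module.finrank_prod, ← Module.Dual.finrank_ker_add_one_of_ne_zero
      (f := e.toLinearMap) (fun h => by simpa [he] using congr($h f₀)), Nat.add_sub_cancel]
  rw [← hdim]
  refine rank_le_of_taylorPoly (restr F c f₀ e) (fun i s => contDiffAt_restr hF he i s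
    (by simpa using (hF.radius_pos i).le)) _ fun s hs => hF.ext s fun i x hx f => ?_
  obtain ⟨S, hS0, hS⟩ := hF.exists_bound s
  -- The order `A * m + 1` is chosen so that each round at least halves the bound, whatever `m` is;
  -- iterating forces the value `0`.
  have hq : (6 * C) ^ m * (1 / 2) ^ (A * m + 1) ≤ (1 / 2 : ℝ) := by
    have h1 : (6 * C) ^ m ≤ (2 ^ A) ^ m := by gcongr
    calc (6 * C) ^ m * (1 / 2) ^ (A * m + 1) ≤ (2 ^ A) ^ m * (1 / 2) ^ (A * m + 1) := by gcongr
      _ = 1 / 2 := by rw [← pow_mul, pow_succ, ← mul_assoc, ← mul_pow]; norm_num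
  have hall : ∀ p : ℕ, ∀ i, ∀ x ∈ Metric.closedBall (c i) (r i), ∀ f,
      ‖F i s x f‖ ≤ S * (1 / 2) ^ p * ‖f‖ ^ m := by
    intro p
    induction p with
    | zero => simpa using hS
    | succ p ih =>
      intro i x hx f
      refine (hF.bound_improve he hf₀ he' s hs (by positivity) ih i x hx f).trans ?_
      rw [pow_succ (1 / 2 : ℝ) p, ← mul_assoc S]
      gcongr
  have hlim : Filter.Tendsto (fun p : ℕ => S * (1 / 2 : ℝ) ^ p * ‖f‖ ^ m) Filter.atTop (𝓝 0) := by
    simpa using ((tendsto_pow_atTop_nhds_zero_of_lt_one (r := (1 / 2 : ℝ)) (by norm_num)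
      (by norm_num)).const_mul S).mul_const (‖f‖ ^ m)
  exact norm_le_zero_iff.1 (ge_of_tendsto' hlim fun p => hall p i x hx f)

end HomogeneousSystem

end RankBound

/-! ### Sections of `𝒪(m)` as homogeneous functions on the vector bundle -/

section SectionsAsFunctions

namespace ProjBundle

variable {X : Type*} (B F : Type*) [NormedAddCommGroup B] [NormedSpace ℂ B]
  [NormedAddCommGroup F] [NormedSpace ℂ F] [FiniteDimensional ℂ F]
  [TopologicalSpace X] [ChartedSpace B X]
  (W : X → Type*) [∀ x, AddCommGroup (W x)] [∀ x, Module ℂ (W x)] [∀ x, TopologicalSpace (W x)]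
  [TopologicalSpace (TotalSpace F W)] [FiberBundle F W] [VectorBundle ℂ F W]
  [IsManifold 𝓘(ℂ, B) ω X] [ContMDiffVectorBundle ω F W 𝓘(ℂ, B)]

/-- The holomorphic sections of `𝒪(m)` on `ℙ W`. -/
abbrev HyperplaneSection (m : ℕ) : Type _ :=
  ContMDiffSection 𝓘(ℂ, B × (Fin (Module.finrank ℂ F - 1) → ℂ)) ℂ ω
    (lineTensorPower (hyperplaneBundle B F W) m).Fiber

variable {B F W} {m : ℕ}

/-- The coefficient of a section of `𝒪(m)` with respect to the frame at a point. -/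
def coeff (s : HyperplaneSection B F W m) (p : ProjBundle B F W) : ℂ := s p

/-- A section of `𝒪(m)` on `ℙ W` as a homogeneous function on the total space of `W`. -/
def secEval (s : HyperplaneSection B F W m) (x : X) (w : W x) : ℂ :=
  open Classical in
  if hw : w = 0 then 0 else
    coeff s ⟨x, Projectivization.mk ℂ w hw⟩ *
      homCoord F W (indexAt (⟨x, Projectivization.mk ℂ w hw⟩ : ProjBundle B F W)) x w ^ m

/-- The value on the zero section is a convention. For `m = 0` it can break continuity there, so
holomorphy is only claimed off the zero section. -/
theorem secEval_zero (s : HyperplaneSection B F W m) (x : X) : secEval s x (0 : W x) = 0 :=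
  dif_pos rfl

theorem secEval_of_ne_zero (s : HyperplaneSection B F W m) {x : X} {w : W x} (hw : w ≠ 0) :
    secEval s x w = coeff s ⟨x, Projectivization.mk ℂ w hw⟩ *
      homCoord F W (indexAt (⟨x, Projectivization.mk ℂ w hw⟩ : ProjBundle B F W)) x w ^ m :=
  dif_neg hw

theorem secEval_smul (s : HyperplaneSection B F W m) (x : X) (w : W x) {t : ℂ} (ht : t ≠ 0) :
    secEval s x (t • w) = t ^ m * secEval s x w := by
  by_cases hw : w = 0
  · rw [hw, smul_zero, secEval_zero, mul_zero]
  · have htw : t • w ≠ 0 := smul_ne_zero ht hw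
    have h : Projectivization.mk ℂ (t • w) htw = Projectivization.mk ℂ w hw :=
      (Projectivization.mk_eq_mk_iff' _ _ _ _ _).2 ⟨t, rfl⟩
    rw [secEval_of_ne_zero s hw, secEval_of_ne_zero s htw, h, map_smul, smul_eq_mul, mul_pow]
    ring

theorem secEval_add (s s' : HyperplaneSection B F W m) (x : X) (w : W x) :
    secEval (s + s') x w = secEval s x w + secEval s' x w := by
  by_cases hw : w = 0
  · subst hw; simp only [secEval_zero, add_zero]
  · simp only [secEval_of_ne_zero _ hw, ← add_mul]
    rfl

theorem secEval_const_smul (a : ℂ) (s : HyperplaneSection B F W m) (x : X) (w : W x) :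
    secEval (a • s) x w = a * secEval s x w := by
  by_cases hw : w = 0
  · subst hw; simp only [secEval_zero, mul_zero]
  · simp only [secEval_of_ne_zero _ hw, ← mul_assoc]
    rfl

theorem homCoord_indexAt_ne_zero {x : X} {w : W x} (hw : w ≠ 0) :
    homCoord F W (indexAt (⟨x, Projectivization.mk ℂ w hw⟩ : ProjBundle B F W)) x w ≠ 0 :=
  ((mem_domain_mk _ x w hw).1 (mem_domain_indexAt B F W ⟨x, Projectivization.mk ℂ w hw⟩)).2.2

theorem eq_zero_of_secEval (s : HyperplaneSection B F W m)
    (h : ∀ x (w : W x), w ≠ 0 → secEval s x w = 0) : s = 0 := by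
  apply ContMDiffSection.ext
  rintro ⟨x, ℓ⟩
  induction ℓ with
  | h w hw =>
    have h1 := h x w hw
    rw [secEval_of_ne_zero s hw] at h1
    exact (mul_eq_zero.1 h1).resolve_right (pow_ne_zero _ (homCoord_indexAt_ne_zero hw))

/-- The coefficient of a section with respect to the frame `i`. -/
def frameCoeff (s : HyperplaneSection B F W m) (i : X × Fin (Module.finrank ℂ F))
    (p : ProjBundle B F W) : ℂ :=
  coordRatio B F W (indexAt p) i p ^ m * coeff s p

/-- `coeff` uses a frame that depends on the point and need not vary continuously. The frame
`indexAt p`, kept fixed, is the trivialization at `p`, in which holomorphy of a section is tested.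
-/
theorem contMDiffAt_frameCoeff (s : HyperplaneSection B F W m) (p : ProjBundle B F W) :
    ContMDiffAt 𝓘(ℂ, B × (Fin (Module.finrank ℂ F - 1) → ℂ)) 𝓘(ℂ, ℂ) ω
      (frameCoeff s (indexAt p)) p := by
  have h := (contMDiffAt_section p).1 (s.contMDiff p)
  refine h.congr_of_eventuallyEq (Filter.Eventually.of_forall fun q => ?_)
  change _ = ((coordRatio B F W (indexAt q) (indexAt p) q • ContinuousLinearMap.id ℂ ℂ) 1 ^ m •
    ContinuousLinearMap.id ℂ ℂ) (s q)
  simp [frameCoeff, coeff]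
  rfl

/-- The `m`-th power of a coordinate ratio is the transition function of `𝒪(m)`, so the homogeneous
function does not depend on the frame. -/
theorem secEval_eq_frameCoeff (s : HyperplaneSection B F W m) {i : X × Fin (Module.finrank ℂ F)}
    {x : X} {w : W x} (hw : w ≠ 0) (hi : homCoord F W i x w ≠ 0) :
    secEval s x w = frameCoeff s i ⟨x, Projectivization.mk ℂ w hw⟩ * homCoord F W i x w ^ m := by
  rw [secEval_of_ne_zero s hw, frameCoeff, coordRatio_mk, div_pow]
  field_simp

variable {N : Type*} [NormedAddCommGroup N] [NormedSpace ℂ N]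

/-- Near `q₀` the frame can be frozen: the value is a holomorphic coefficient at the line spanned by
`w q`, times the `m`-th power of a homogeneous coordinate of `w q`. `Q` is that line in an affine
chart. -/
theorem contDiffAt_secEval (s : HyperplaneSection B F W m) {x : N → X} {w : ∀ q, W (x q)} {q₀ : N}
    (h : ContMDiffAt 𝓘(ℂ, N) (𝓘(ℂ, B).prod 𝓘(ℂ, F)) ω
      (fun q => (⟨x q, w q⟩ : TotalSpace F W)) q₀) (hw : w q₀ ≠ 0) :
    ContDiffAt ℂ ω (fun q => secEval s (x q) (w q)) q₀ := by
  rw [contMDiffAt_totalSpace] at h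
  obtain ⟨hx, ht⟩ := h
  simp only at hx ht
  let p₀ : ProjBundle B F W := ⟨x q₀, Projectivization.mk ℂ (w q₀) hw⟩
  let i := indexAt p₀
  have hi1 : i.1 = x q₀ := rfl
  have hbase : ∀ᶠ q in 𝓝 q₀, x q ∈ (trivializationAt F W (x q₀)).baseSet :=
    hx.continuousAt.eventually ((trivializationAt F W (x q₀)).open_baseSet.mem_nhds
      (mem_baseSet_trivializationAt F W (x q₀)))
  have hchart : ∀ᶠ q in 𝓝 q₀, x q ∈ (chartAt B (x q₀)).source :=
    hx.continuousAt.eventually ((chartAt B (x q₀)).open_source.mem_nhds (mem_chart_source B (x q₀)))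
  have hcoord : ∀ c, ContDiffAt ℂ ω (fun q => homCoord F W (x q₀, c) (x q) (w q)) q₀ := by
    intro c
    have h1 := ((Module.finBasis ℂ F).coord c).toContinuousLinearMap.contDiff.contDiffAt.comp q₀
      ht.contDiffAt
    refine h1.congr_of_eventuallyEq ?_
    filter_upwards [hbase] with q hq
    simp only [homCoord, LinearMap.comp_apply, Function.comp_apply,
      LinearMap.coe_toContinuousLinearMap']
    rw [Trivialization.coe_linearMapAt_of_mem _ hq]
  have hne₀ : homCoord F W i (x q₀) (w q₀) ≠ 0 := homCoord_indexAt_ne_zero hw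
  have hne : ∀ᶠ q in 𝓝 q₀, homCoord F W i (x q) (w q) ≠ 0 :=
    (hcoord i.2).continuousAt.eventually (isOpen_ne.mem_nhds hne₀)
  let Q : N → B × (Fin (Module.finrank ℂ F - 1) → ℂ) := fun q =>
    (chartAt B (x q₀) (x q), fun l => homCoord F W (x q₀, otherIndex i.2 l) (x q) (w q) /
      homCoord F W i (x q) (w q))
  have hQ : ContDiffAt ℂ ω Q q₀ := by
    refine ContDiffAt.prodMk ?_ (contDiffAt_pi.2 fun l => (hcoord _).div (hcoord i.2) hne₀)
    have h2 : ContMDiffAt 𝓘(ℂ, B) 𝓘(ℂ, B) ω (chartAt B (x q₀)) (x q₀) :=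
      contMDiffOn_chart.contMDiffAt ((chartAt B (x q₀)).open_source.mem_nhds
        (mem_chart_source B (x q₀)))
    exact (h2.comp q₀ hx).contDiffAt
  have hw0 : ∀ᶠ q in 𝓝 q₀, w q ≠ 0 := hne.mono fun q hq h0 => hq (by rw [h0, map_zero])
  have hQeq : ∀ q (h0 : w q ≠ 0), chart B F W i ⟨x q, Projectivization.mk ℂ (w q) h0⟩ = Q q := by
    intro q h0
    refine Prod.ext rfl (funext fun l => ?_)
    change coordRatio B F W _ _ _ = _
    rw [coordRatio_mk]
    rfl
  have hp₀ : p₀ ∈ domain B F W i := mem_domain_indexAt B F W p₀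
  have hQ₀ : Q q₀ = chart B F W i p₀ := (hQeq q₀ hw).symm
  have hsymm : ContMDiffAt 𝓘(ℂ, B × (Fin (Module.finrank ℂ F - 1) → ℂ))
      𝓘(ℂ, B × (Fin (Module.finrank ℂ F - 1) → ℂ)) ω (chartAt _ p₀).symm (Q q₀) := by
    refine contMDiffOn_chart_symm.contMDiffAt ((chartAt _ p₀).open_target.mem_nhds ?_)
    rw [hQ₀]
    exact (chart B F W i).map_source hp₀
  have hinv : (chartAt (B × (Fin (Module.finrank ℂ F - 1) → ℂ)) p₀).symm (Q q₀) = p₀ := by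
    rw [hQ₀]
    exact (chart B F W i).left_inv hp₀
  have h3 : ContMDiffAt 𝓘(ℂ, N) 𝓘(ℂ, ℂ) ω
      (fun q => frameCoeff s i ((chartAt (B × (Fin (Module.finrank ℂ F - 1) → ℂ)) p₀).symm (Q q)))
      q₀ := by
    exact (contMDiffAt_frameCoeff s p₀).comp_of_eq (hsymm.comp q₀ hQ.contMDiffAt) hinv
  refine (h3.contDiffAt.mul ((hcoord i.2).pow m)).congr_of_eventuallyEq ?_
  filter_upwards [hbase, hchart, hne, hw0] with q h1 h2 h4 h5
  rw [secEval_eq_frameCoeff s h5 h4, ← hQeq q h5]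
  congr 2
  exact ((chart B F W i).left_inv ((mem_domain_mk _ _ _ _).2 ⟨h2, h1, h4⟩)).symm

end ProjBundle

end SectionsAsFunctions

/-! ### Sections over the cotangent bundle in local parametrizations -/

section Cotangent

open ProjBundle

variable (B X : Type*) [NormedAddCommGroup B] [NormedSpace ℂ B] [FiniteDimensional ℂ B]
  [TopologicalSpace X] [ChartedSpace B X] [IsManifold 𝓘(ℂ, B) ω X]

/-- The holomorphic sections of `𝒪(m)` on the projectivized cotangent bundle. -/
abbrev CotangentSection (m : ℕ) : Type _ :=
  HyperplaneSection B (B →L[ℂ] ℂ)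
    (fun x : X => TangentSpace 𝓘(ℂ, B) x →L[ℂ] Bundle.Trivial X ℂ x) m

variable {B X} {m : ℕ}

/-- The value of a section at a covector. -/
def covEval (s : CotangentSection B X m) (x : X) (w : B →L[ℂ] ℂ) : ℂ :=
  secEval (F := B →L[ℂ] ℂ)
    (W := fun x : X => TangentSpace 𝓘(ℂ, B) x →L[ℂ] Bundle.Trivial X ℂ x) s x w

/-- The derivative of a map from the model space, without dependent types. -/
def plotDeriv (g : B → X) (b : B) : B →L[ℂ] B := mfderiv 𝓘(ℂ, B) 𝓘(ℂ, B) g b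

/-- The value of a section at the covector that is `f` in the coordinates given by a local
parametrization `g`. -/
def plotEval (s : CotangentSection B X m) (g : B → X) (b : B) (f : B →L[ℂ] ℂ) : ℂ :=
  covEval s (g b) (f ∘L (plotDeriv g b).inverse)

theorem covEval_zero (s : CotangentSection B X m) (x : X) : covEval s x 0 = 0 :=
  secEval_zero s x

theorem covEval_smul (s : CotangentSection B X m) (x : X) (w : B →L[ℂ] ℂ) {t : ℂ} (ht : t ≠ 0) :
    covEval s x (t • w) = t ^ m * covEval s x w :=
  secEval_smul s x _ ht

theorem covEval_add (s s' : CotangentSection B X m) (x : X) (w : B →L[ℂ] ℂ) :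
    covEval (s + s') x w = covEval s x w + covEval s' x w :=
  secEval_add s s' x _

theorem covEval_const_smul (a : ℂ) (s : CotangentSection B X m) (x : X) (w : B →L[ℂ] ℂ) :
    covEval (a • s) x w = a * covEval s x w :=
  secEval_const_smul a s x _

theorem eq_zero_of_covEval (s : CotangentSection B X m) (h : ∀ x w, covEval s x w = 0) : s = 0 :=
  eq_zero_of_secEval s fun x w _ => h x w

theorem plotEval_smul (s : CotangentSection B X m) (g : B → X) (b : B) (f : B →L[ℂ] ℂ) {t : ℂ}
    (ht : t ≠ 0) : plotEval s g b (t • f) = t ^ m * plotEval s g b f := by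
  rw [plotEval, ContinuousLinearMap.smul_comp, covEval_smul _ _ _ ht, plotEval]

theorem plotEval_zero (s : CotangentSection B X m) (g : B → X) (b : B) : plotEval s g b 0 = 0 := by
  rw [plotEval, ContinuousLinearMap.zero_comp, covEval_zero]

variable (m) in
/-- The evaluation of sections in local coordinates, as linear functionals. -/
def plotEvalLinear (g : B → X) : CotangentSection B X m →ₗ[ℂ] (B → (B →L[ℂ] ℂ) → ℂ) where
  toFun s b f := plotEval s g b f
  map_add' s s' := by ext b f; exact covEval_add s s' _ _
  map_smul' a s := by ext b f; exact covEval_const_smul a s _ _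

theorem covEval_eq_plotEval (s : CotangentSection B X m) {g : B → X} {b : B}
    (hg : (plotDeriv g b).IsInvertible) (w : B →L[ℂ] ℂ) :
    covEval s (g b) w = plotEval s g b (w ∘L plotDeriv g b) := by
  rw [plotEval, ContinuousLinearMap.comp_assoc, hg.self_comp_inverse, ContinuousLinearMap.comp_id]

/-- The chain rule: a covector with coordinates `f` in `g'` has coordinates `f ∘L fderiv ℂ h b` in
`g`. -/
theorem plotEval_comp (s : CotangentSection B X m) {g g' : B → X} {h : B → B} {b : B}
    (hgh : g =ᶠ[𝓝 b] g' ∘ h) (hg' : MDifferentiableAt 𝓘(ℂ, B) 𝓘(ℂ, B) g' (h b))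
    (hi : (plotDeriv g' (h b)).IsInvertible) (hh : DifferentiableAt ℂ h b)
    (hhi : (fderiv ℂ h b).IsInvertible) (f : B →L[ℂ] ℂ) :
    plotEval s g b (f ∘L fderiv ℂ h b) = plotEval s g' (h b) f := by
  have h1 : plotDeriv g b = plotDeriv g' (h b) ∘L fderiv ℂ h b := by
    rw [plotDeriv, hgh.mfderiv_eq, mfderiv_comp b hg' hh.mdifferentiableAt, mfderiv_eq_fderiv]
    rfl
  rw [plotEval, plotEval, h1, hi.inverse_comp_of_left, hgh.self_of_nhds, Function.comp_apply,
    ContinuousLinearMap.comp_assoc, ← ContinuousLinearMap.comp_assoc (fderiv ℂ h b),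
    hhi.self_comp_inverse, ContinuousLinearMap.id_comp]

/-- Inversion of operators is analytic at invertible ones, so the covector `f ∘L (plotDeriv g
b).inverse` varies holomorphically with `(b, f)`, and `contDiffAt_secEval` applies. -/
theorem contDiffAt_plotEval (s : CotangentSection B X m) {g : B → X} {b : B} {f : B →L[ℂ] ℂ}
    (hg : ContMDiffAt 𝓘(ℂ, B) 𝓘(ℂ, B) ω g b) (hi : (plotDeriv g b).IsInvertible) (hf : f ≠ 0) :
    ContDiffAt ℂ ω (fun q : B × (B →L[ℂ] ℂ) => plotEval s g q.1 q.2) (b, f) := by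
  have : FiniteDimensional ℂ (B →L[ℂ] ℂ) := inferInstance
  have : CompleteSpace B := FiniteDimensional.complete ℂ B
  refine contDiffAt_secEval (F := B →L[ℂ] ℂ)
    (W := fun x : X => TangentSpace 𝓘(ℂ, B) x →L[ℂ] Bundle.Trivial X ℂ x) s
    (x := fun q : B × (B →L[ℂ] ℂ) => g q.1) (w := fun q => q.2 ∘L (plotDeriv g q.1).inverse)
    ?_ ?_
  · rw [contMDiffAt_hom_bundle]
    have hg1 : ContMDiffAt 𝓘(ℂ, B × (B →L[ℂ] ℂ)) 𝓘(ℂ, B) ω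
        (fun q : B × (B →L[ℂ] ℂ) => g q.1) (b, f) :=
      hg.comp (b, f) (contDiff_fst.contDiffAt.contMDiffAt)
    refine ⟨hg1, ?_⟩
    have h1 := (hg.mfderiv_const (m := ω) le_rfl).contDiffAt
    let A : X → B →L[ℂ] B := fun x =>
      (trivializationAt B (TangentSpace 𝓘(ℂ, B) : X → Type _) (g b)).continuousLinearMapAt ℂ x
    let A' : X → B →L[ℂ] B := fun x =>
      (trivializationAt B (TangentSpace 𝓘(ℂ, B) : X → Type _) (g b)).symmL ℂ x
    have hA : ∀ x ∈ (trivializationAt B (TangentSpace 𝓘(ℂ, B) : X → Type _) (g b)).baseSet,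
        ∃ e : B ≃L[ℂ] B, (e : B →L[ℂ] B) = A x ∧ (e.symm : B →L[ℂ] B) = A' x := fun x hx =>
      ⟨(trivializationAt B (TangentSpace 𝓘(ℂ, B) : X → Type _)
        (g b)).continuousLinearEquivAt ℂ x hx, ContinuousLinearMap.ext fun v =>
          congrFun (Trivialization.coe_continuousLinearEquivAt_eq _ hx) v,
        ContinuousLinearMap.ext fun v =>
          congrFun (Trivialization.symm_continuousLinearEquivAt_eq _ hx) v⟩
    -- The source is a vector space, whose tangent trivialization is the identity; only the
    -- trivialization `A` of the target enters.
    have hT : ∀ b', inTangentCoordinates 𝓘(ℂ, B) 𝓘(ℂ, B) id g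
        (mfderiv 𝓘(ℂ, B) 𝓘(ℂ, B) g) b b' = A (g b') ∘L plotDeriv g b' := by
      intro b'
      simp only [inTangentCoordinates, ContinuousLinearMap.inCoordinates, id,
        TangentBundle.symmL_model_space]
      rfl
    have hTi : (inTangentCoordinates 𝓘(ℂ, B) 𝓘(ℂ, B) id g
        (mfderiv 𝓘(ℂ, B) 𝓘(ℂ, B) g) b b).IsInvertible := by
      obtain ⟨e, he, -⟩ := hA (g b) (mem_baseSet_trivializationAt B _ (g b))
      rw [hT, ← he]
      exact ContinuousLinearMap.IsInvertible.comp ⟨e, rfl⟩ hi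
    have h2 : ContDiffAt ℂ ω (fun b' => (inTangentCoordinates 𝓘(ℂ, B) 𝓘(ℂ, B) id g
        (mfderiv 𝓘(ℂ, B) 𝓘(ℂ, B) g) b b').inverse) b :=
      hTi.contDiffAt_map_inverse.comp b h1
    have h3 : ContDiffAt ℂ ω (fun q : B × (B →L[ℂ] ℂ) => q.2 ∘L
        (inTangentCoordinates 𝓘(ℂ, B) 𝓘(ℂ, B) id g
          (mfderiv 𝓘(ℂ, B) 𝓘(ℂ, B) g) b q.1).inverse) (b, f) :=
      contDiffAt_snd.clm_comp (h2.comp (b, f) contDiffAt_fst)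
    refine h3.contMDiffAt.congr_of_eventuallyEq ?_
    filter_upwards [hg1.continuousAt.eventually
      ((trivializationAt B (TangentSpace 𝓘(ℂ, B) : X → Type _) (g b)).open_baseSet.mem_nhds
      (mem_baseSet_trivializationAt B _ (g b)))] with q hq
    obtain ⟨e, he, he'⟩ := hA (g q.1) hq
    rw [hT, ← he, ContinuousLinearMap.inverse_equiv_comp, he']
    have h4 := Bundle.Trivial.continuousLinearMapAt_trivialization ℂ X ℂ (g q.1)
    refine ContinuousLinearMap.ext fun v => ?_
    exact congr($h4 (q.2 ((plotDeriv g q.1).inverse (A' (g q.1) v))))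
  · intro h0
    apply hf
    have h1 : (f ∘L (plotDeriv g b).inverse) ∘L plotDeriv g b = 0 := by
      change f ∘L (plotDeriv g b).inverse = 0 at h0
      rw [h0, ContinuousLinearMap.zero_comp]
    rwa [ContinuousLinearMap.comp_assoc, hi.inverse_comp_self, ContinuousLinearMap.comp_id] at h1

end Cotangent

/-! ### Derivatives as endomorphisms of the model space -/

section ModelDerivative

variable (B : Type*) {Y Z T : Type*} [NormedAddCommGroup B] [NormedSpace ℂ B]
  [TopologicalSpace Y] [ChartedSpace B Y] [TopologicalSpace Z] [ChartedSpace B Z]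
  [TopologicalSpace T] [ChartedSpace B T]

/-- The derivative of a map between manifolds modelled on the same space, without dependent types. -/
def modelDeriv (f : Y → Z) (y : Y) : B →L[ℂ] B := mfderiv 𝓘(ℂ, B) 𝓘(ℂ, B) f y

theorem modelDeriv_comp {f : Y → Z} {g : Z → T} (y : Y)
    (hg : MDifferentiableAt 𝓘(ℂ, B) 𝓘(ℂ, B) g (f y)) (hf : MDifferentiableAt 𝓘(ℂ, B) 𝓘(ℂ, B) f y) :
    modelDeriv B (g ∘ f) y = modelDeriv B g (f y) ∘L modelDeriv B f y :=
  mfderiv_comp y hg hf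

theorem modelDeriv_congr {f g : Y → Z} {y : Y} (h : f =ᶠ[𝓝 y] g) :
    modelDeriv B f y = modelDeriv B g y := by
  rw [modelDeriv, h.mfderiv_eq]; rfl

theorem modelDeriv_comp_of_eventually_id {f : Y → Z} {g : Z → Y} {y : Y}
    (hg : MDifferentiableAt 𝓘(ℂ, B) 𝓘(ℂ, B) g (f y)) (hf : MDifferentiableAt 𝓘(ℂ, B) 𝓘(ℂ, B) f y)
    (h : g ∘ f =ᶠ[𝓝 y] id) :
    modelDeriv B g (f y) ∘L modelDeriv B f y = ContinuousLinearMap.id ℂ B := by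
  rw [← modelDeriv_comp B y hg hf, modelDeriv_congr B h]
  exact mfderiv_id

theorem isInvertible_modelDeriv {f : Y → Z} {g : Z → Y} {y : Y}
    (hg : MDifferentiableAt 𝓘(ℂ, B) 𝓘(ℂ, B) g (f y)) (hf : MDifferentiableAt 𝓘(ℂ, B) 𝓘(ℂ, B) f y)
    (h : g ∘ f =ᶠ[𝓝 y] id) (h' : f ∘ g =ᶠ[𝓝 (f y)] id) : (modelDeriv B f y).IsInvertible := by
  have hy : g (f y) = y := h.self_of_nhds
  refine ContinuousLinearMap.IsInvertible.of_inverse (g := modelDeriv B g (f y)) ?_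
    (modelDeriv_comp_of_eventually_id B hg hf h)
  have := modelDeriv_comp_of_eventually_id B (f := g) (g := f) (y := f y) (by rwa [hy]) hg h'
  rwa [hy] at this

theorem isInvertible_of_comp_left {P A : B →L[ℂ] B} (hA : A.IsInvertible)
    (h : (A ∘L P).IsInvertible) : P.IsInvertible := by
  obtain ⟨e, rfl⟩ := hA
  exact ContinuousLinearMap.isInvertible_equiv_comp.1 h

end ModelDerivative

/-! ### The covering of the suspension and its parametrizations -/

section SuspensionCovering

variable {k : ℕ} {E M : Type*} [NormedAddCommGroup E] [NormedSpace ℂ E]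
    [TopologicalSpace M] [ChartedSpace E M] [T2Space M] [LocallyCompactSpace M]
    [IsManifold 𝓘(ℂ, E) ω M]
    {Λ : Submodule ℤ (EuclideanSpace ℂ (Fin k))} [DiscreteTopology Λ]
    (ρ : Multiplicative Λ →* HolAut E M)

namespace Susp

/-- The covering `ℂᵏ × M → ℂᵏ ×^Λ M`. -/
def proj (p : SuspCover ρ) : Susp ρ := Quotient.mk _ p

theorem proj_surjective : Function.Surjective (proj ρ) := Quotient.mk_surjective

theorem proj_smul (γ : Multiplicative Λ) (p : SuspCover ρ) : proj ρ (γ • p) = proj ρ p :=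
  Quotient.sound (MulAction.orbitRel_apply.2 ⟨γ, rfl⟩)

theorem exists_smul_of_proj_eq {p p' : SuspCover ρ} (h : proj ρ p = proj ρ p') :
    ∃ γ : Multiplicative Λ, γ • p = p' := by
  obtain ⟨γ, hγ⟩ := MulAction.orbitRel_apply.1 (Quotient.exact h)
  exact ⟨γ⁻¹, by rw [← hγ]; exact inv_smul_smul γ p'⟩

theorem isLocalHomeomorph_proj : IsLocalHomeomorph (proj ρ) :=
  (isQuotientCoveringMap_quotientMk_of_properlyDiscontinuousSMul (G := Multiplicative Λ)
    (E := SuspCover ρ)).isCoveringMap.isLocalHomeomorph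

theorem continuous_proj : Continuous (proj ρ) := (isLocalHomeomorph_proj ρ).continuous

/-- In charts, the covering is locally the action of an element of the group. -/
theorem exists_chartAt_proj_eq (p : SuspCover ρ) : ∃ (p₀ : SuspCover ρ) (γ : Multiplicative Λ),
    γ • p = p₀ ∧ chartAt (EuclideanSpace ℂ (Fin k) × E) (proj ρ p) ∘ proj ρ =ᶠ[𝓝 p]
      chartAt (EuclideanSpace ℂ (Fin k) × E) p₀ ∘ (γ • ·) := by
  have hf := isLocalHomeomorph_proj ρ
  let g := (proj_surjective ρ).hasRightInverse.choose
  have hg : Function.RightInverse g (proj ρ) := (proj_surjective ρ).hasRightInverse.choose_spec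
  -- The chart at `proj ρ p` is built from a chosen preimage, in general not `p`. Some `γ` carries
  -- `p` to it, and the local inverse there composed with `proj ρ` is the action of `γ` near `p`.
  obtain ⟨γ, hγ⟩ := exists_smul_of_proj_eq ρ (hg (proj ρ p)).symm
  refine ⟨g (proj ρ p), γ, hγ, ?_⟩
  have hchart : chartAt (EuclideanSpace ℂ (Fin k) × E) (proj ρ p) =
      (hf.localInverseAt (g (proj ρ p))).trans (chartAt _ (g (proj ρ p))) := rfl
  set L := hf.localInverseAt (g (proj ρ p)) with hL
  have hLs : ∀ y, L.symm y = proj ρ y := fun y => by rw [hL, hf.localInverseAt_symm]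
  have hmem : γ • p ∈ L.target := by
    rw [hγ, hL]
    exact hf.self_mem_localInverseAt_target
  have hcont : ContinuousAt (fun q : SuspCover ρ => γ • q) p :=
    (SuspCover.contMDiff_smul ρ γ).continuous.continuousAt
  filter_upwards [hcont.eventually (L.open_target.mem_nhds hmem)] with q hq
  simp only [Function.comp_apply, hchart, OpenPartialHomeomorph.coe_trans]
  congr 1
  rw [← proj_smul ρ γ q, ← hLs, L.right_inv hq]

theorem contMDiff_proj : ContMDiff 𝓘(ℂ, EuclideanSpace ℂ (Fin k) × E)
    𝓘(ℂ, EuclideanSpace ℂ (Fin k) × E) ω (proj ρ) := by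
  intro p
  obtain ⟨p₀, γ, hγ, h⟩ := exists_chartAt_proj_eq ρ p
  rw [contMDiffAt_iff_target]
  refine ⟨(continuous_proj ρ).continuousAt, ?_⟩
  have h1 : ContMDiffAt 𝓘(ℂ, EuclideanSpace ℂ (Fin k) × E) 𝓘(ℂ, EuclideanSpace ℂ (Fin k) × E) ω
      (chartAt (EuclideanSpace ℂ (Fin k) × E) p₀) (γ • p) := by
    rw [hγ]
    exact contMDiffOn_chart.contMDiffAt ((chartAt _ p₀).open_source.mem_nhds (mem_chart_source _ p₀))
  exact (h1.comp p (SuspCover.contMDiff_smul ρ γ p)).congr_of_eventuallyEq h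

theorem isInvertible_modelDeriv_smul (γ : Multiplicative Λ) (p : SuspCover ρ) :
    (modelDeriv (EuclideanSpace ℂ (Fin k) × E) (fun q : SuspCover ρ => γ • q) p).IsInvertible := by
  refine isInvertible_modelDeriv _ (g := fun q => γ⁻¹ • q)
    ((SuspCover.contMDiff_smul ρ γ⁻¹).mdifferentiable (by simp) _)
    ((SuspCover.contMDiff_smul ρ γ).mdifferentiable (by simp) _)
    (Filter.Eventually.of_forall fun q => ?_) (Filter.Eventually.of_forall fun q => ?_)
  · simp
  · simp

theorem isInvertible_modelDeriv_chartAt {B Y : Type*} [NormedAddCommGroup B] [NormedSpace ℂ B]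
    [TopologicalSpace Y] [ChartedSpace B Y] [IsManifold 𝓘(ℂ, B) ω Y] (y : Y) :
    (modelDeriv B (chartAt B y) y).IsInvertible := by
  have := isInvertible_mfderiv_extChartAt (I := 𝓘(ℂ, B)) (mem_extChartAt_source (I := 𝓘(ℂ, B)) y)
  simp only [mfld_simps] at this
  exact this

/-- In charts the covering is the action of some `γ`, whose derivative is invertible; the derivative
of the chart downstairs is then cancelled. -/
theorem isInvertible_modelDeriv_proj (p : SuspCover ρ) :
    (modelDeriv (EuclideanSpace ℂ (Fin k) × E) (proj ρ) p).IsInvertible := by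
  obtain ⟨p₀, γ, hγ, h⟩ := exists_chartAt_proj_eq ρ p
  refine isInvertible_of_comp_left _ (isInvertible_modelDeriv_chartAt (proj ρ p)) ?_
  have hc : ∀ {Y : Type _} [TopologicalSpace Y] [ChartedSpace (EuclideanSpace ℂ (Fin k) × E) Y]
      [IsManifold 𝓘(ℂ, EuclideanSpace ℂ (Fin k) × E) ω Y] (y : Y),
      MDifferentiableAt 𝓘(ℂ, EuclideanSpace ℂ (Fin k) × E) 𝓘(ℂ, EuclideanSpace ℂ (Fin k) × E)
        (chartAt (EuclideanSpace ℂ (Fin k) × E) y) y := fun y =>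
    mdifferentiableAt_atlas (chart_mem_atlas _ y) (mem_chart_source _ y)
  rw [← modelDeriv_comp _ p (hc _) ((contMDiff_proj ρ).mdifferentiable (by simp) p),
    modelDeriv_congr _ h, modelDeriv_comp _ p (by rw [hγ]; exact hc p₀)
      ((SuspCover.contMDiff_smul ρ γ).mdifferentiable (by simp) p)]
  refine ContinuousLinearMap.IsInvertible.comp ?_ (isInvertible_modelDeriv_smul ρ γ p)
  rw [hγ]
  exact isInvertible_modelDeriv_chartAt p₀

/-- The local parametrizations of `ℂᵏ ×^Λ M` by `ℂᵏ` times the image of a chart of `M`. -/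
def plot (m₀ : M) (b : EuclideanSpace ℂ (Fin k) × E) : Susp ρ :=
  proj ρ (b.1, (chartAt E m₀).symm b.2)

/-- A point of the covering over a point of `M`. -/
def coverPoint (m₀ : M) : SuspCover ρ := (0, m₀)

/-- The chart of the factor `ℂᵏ` is the identity, so only `b.2` is constrained. Plots are therefore
good over all of `ℂᵏ`, as Liouville's theorem requires. -/
theorem mem_chartAt_cover_target {m₀ : M} {b : EuclideanSpace ℂ (Fin k) × E}
    (hb : b.2 ∈ (chartAt E m₀).target) :
    b ∈ (chartAt (EuclideanSpace ℂ (Fin k) × E) (coverPoint ρ m₀)).target :=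
  ⟨Set.mem_univ _, hb⟩

variable {m₀ m₁ : M} {b : EuclideanSpace ℂ (Fin k) × E}

theorem contMDiffAt_cover_symm (hb : b.2 ∈ (chartAt E m₀).target) :
    ContMDiffAt 𝓘(ℂ, EuclideanSpace ℂ (Fin k) × E) 𝓘(ℂ, EuclideanSpace ℂ (Fin k) × E) ω
      (chartAt (EuclideanSpace ℂ (Fin k) × E) (coverPoint ρ m₀)).symm b :=
  contMDiffOn_chart_symm.contMDiffAt
    ((chartAt (EuclideanSpace ℂ (Fin k) × E) (coverPoint ρ m₀)).open_target.mem_nhds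
      (mem_chartAt_cover_target ρ hb))

theorem contMDiffAt_plot (hb : b.2 ∈ (chartAt E m₀).target) :
    ContMDiffAt 𝓘(ℂ, EuclideanSpace ℂ (Fin k) × E) 𝓘(ℂ, EuclideanSpace ℂ (Fin k) × E) ω
      (plot ρ m₀) b :=
  (contMDiff_proj ρ _).comp b (contMDiffAt_cover_symm ρ hb)

theorem isInvertible_modelDeriv_chart_symm {B Y : Type*} [NormedAddCommGroup B] [NormedSpace ℂ B]
    [TopologicalSpace Y] [ChartedSpace B Y] [IsManifold 𝓘(ℂ, B) ω Y] (y : Y) {z : B}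
    (hz : z ∈ (chartAt B y).target) : (modelDeriv B (chartAt B y).symm z).IsInvertible := by
  have hs := (chartAt B y).map_target hz
  refine isInvertible_modelDeriv B (g := chartAt B y)
    (mdifferentiableAt_atlas (chart_mem_atlas B y) hs)
    (mdifferentiableAt_atlas_symm (chart_mem_atlas B y) hz) ?_ ?_
  · filter_upwards [(chartAt B y).open_target.mem_nhds hz] with w hw
    exact (chartAt B y).right_inv hw
  · filter_upwards [(chartAt B y).open_source.mem_nhds hs] with w hw
    exact (chartAt B y).left_inv hw

theorem isInvertible_plotDeriv_plot (hb : b.2 ∈ (chartAt E m₀).target) :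
    (plotDeriv (plot ρ m₀) b).IsInvertible := by
  have h := modelDeriv_comp (EuclideanSpace ℂ (Fin k) × E) b
    ((contMDiff_proj ρ).mdifferentiable (by simp) _)
    ((contMDiffAt_cover_symm ρ hb).mdifferentiableAt (by simp))
  change (modelDeriv (EuclideanSpace ℂ (Fin k) × E) (plot ρ m₀) b).IsInvertible
  refine (congrArg ContinuousLinearMap.IsInvertible h).mpr ?_
  exact (isInvertible_modelDeriv_proj ρ _).comp
    (isInvertible_modelDeriv_chart_symm _ (mem_chartAt_cover_target ρ hb))

end Susp

end SuspensionCovering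

/-! ### Automorphisms in charts and the transformation law of sections -/

section TransitionMaps

variable {E M : Type*} [NormedAddCommGroup E] [NormedSpace ℂ E]
    [TopologicalSpace M] [ChartedSpace E M]

/-- A biholomorphic map in two charts. -/
def autInCharts (m₀ m₁ : M) (φ : HolAut E M) (z : E) : E :=
  chartAt E m₁ ((φ : M ≃ₜ M) ((chartAt E m₀).symm z))

theorem contDiffAt_autInCharts [IsManifold 𝓘(ℂ, E) ω M] {m₀ m₁ : M} (φ : HolAut E M) {z : E}
    (hz : z ∈ (chartAt E m₀).target)
    (hφ : (φ : M ≃ₜ M) ((chartAt E m₀).symm z) ∈ (chartAt E m₁).source) :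
    ContDiffAt ℂ ω (autInCharts m₀ m₁ φ) z := by
  have h1 : ContMDiffAt 𝓘(ℂ, E) 𝓘(ℂ, E) ω (chartAt E m₀).symm z :=
    contMDiffOn_chart_symm.contMDiffAt ((chartAt E m₀).open_target.mem_nhds hz)
  have h2 : ContMDiffAt 𝓘(ℂ, E) 𝓘(ℂ, E) ω (chartAt E m₁)
      ((φ : M ≃ₜ M) ((chartAt E m₀).symm z)) :=
    contMDiffOn_chart.contMDiffAt ((chartAt E m₁).open_source.mem_nhds hφ)
  exact (h2.comp z ((φ.2.1 _).comp z h1)).contDiffAt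

theorem autInCharts_inv {m₀ m₁ : M} (φ : HolAut E M) {z : E} (hz : z ∈ (chartAt E m₀).target)
    (hφ : (φ : M ≃ₜ M) ((chartAt E m₀).symm z) ∈ (chartAt E m₁).source) :
    autInCharts m₁ m₀ φ⁻¹ (autInCharts m₀ m₁ φ z) = z := by
  rw [autInCharts, autInCharts, (chartAt E m₁).left_inv hφ]
  change chartAt E m₀ ((φ : M ≃ₜ M).symm _) = z
  rw [Homeomorph.symm_apply_apply, (chartAt E m₀).right_inv hz]

theorem symm_autInCharts {m₀ m₁ : M} (φ : HolAut E M) {z : E}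
    (hφ : (φ : M ≃ₜ M) ((chartAt E m₀).symm z) ∈ (chartAt E m₁).source) :
    (chartAt E m₁).symm (autInCharts m₀ m₁ φ z) = (φ : M ≃ₜ M) ((chartAt E m₀).symm z) :=
  (chartAt E m₁).left_inv hφ

theorem eventually_mem_autInCharts {m₀ m₁ : M} (φ : HolAut E M) {z : E}
    (hz : z ∈ (chartAt E m₀).target)
    (hφ : (φ : M ≃ₜ M) ((chartAt E m₀).symm z) ∈ (chartAt E m₁).source) :
    ∀ᶠ z' in 𝓝 z, z' ∈ (chartAt E m₀).target ∧
      (φ : M ≃ₜ M) ((chartAt E m₀).symm z') ∈ (chartAt E m₁).source :=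
  Filter.Eventually.and ((chartAt E m₀).open_target.mem_nhds hz)
    (((φ : M ≃ₜ M).continuous.continuousAt.comp ((chartAt E m₀).continuousAt_symm hz)).eventually
      ((chartAt E m₁).open_source.mem_nhds hφ))

theorem isInvertible_fderiv_autInCharts [IsManifold 𝓘(ℂ, E) ω M] {m₀ m₁ : M} (φ : HolAut E M)
    {z : E} (hz : z ∈ (chartAt E m₀).target)
    (hφ : (φ : M ≃ₜ M) ((chartAt E m₀).symm z) ∈ (chartAt E m₁).source) :
    (fderiv ℂ (autInCharts m₀ m₁ φ) z).IsInvertible := by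
  have hz' : autInCharts m₀ m₁ φ z ∈ (chartAt E m₁).target := (chartAt E m₁).map_source hφ
  have hφ' : ((φ⁻¹ : HolAut E M) : M ≃ₜ M) ((chartAt E m₁).symm (autInCharts m₀ m₁ φ z)) ∈
      (chartAt E m₀).source := by
    rw [symm_autInCharts φ hφ]
    change (φ : M ≃ₜ M).symm _ ∈ _
    rw [Homeomorph.symm_apply_apply]
    exact (chartAt E m₀).map_target hz
  rw [← mfderiv_eq_fderiv]
  refine isInvertible_modelDeriv E (g := autInCharts m₁ m₀ φ⁻¹)
    ((contDiffAt_autInCharts φ⁻¹ hz' hφ').differentiableAt (by simp)).mdifferentiableAt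
    ((contDiffAt_autInCharts φ hz hφ).differentiableAt (by simp)).mdifferentiableAt ?_ ?_
  · filter_upwards [eventually_mem_autInCharts φ hz hφ] with w hw
    exact autInCharts_inv φ hw.1 hw.2
  · filter_upwards [eventually_mem_autInCharts φ⁻¹ hz' hφ'] with w hw
    have := autInCharts_inv φ⁻¹ hw.1 hw.2
    rwa [inv_inv] at this

variable [T2Space M] [LocallyCompactSpace M] [IsManifold 𝓘(ℂ, E) ω M] [FiniteDimensional ℂ E]
    {k : ℕ} {Λ : Submodule ℤ (EuclideanSpace ℂ (Fin k))} [DiscreteTopology Λ]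
    {ρ : Multiplicative Λ →* HolAut E M} {m : ℕ}

theorem Susp.plot_translate {m₀ m₁ : M} (γ : Multiplicative Λ) {b : EuclideanSpace ℂ (Fin k) × E}
    (hφ : (ρ γ : M ≃ₜ M) ((chartAt E m₀).symm b.2) ∈ (chartAt E m₁).source) :
    Susp.plot ρ m₁ (γ.toAdd + b.1, autInCharts m₀ m₁ (ρ γ) b.2) = Susp.plot ρ m₀ b := by
  rw [Susp.plot, Susp.plot, symm_autInCharts _ hφ,
    ← Susp.proj_smul ρ γ ((b.1, (chartAt E m₀).symm b.2) : SuspCover ρ)]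
  rfl

/-- The transformation law of sections under the group. -/
theorem plotEval_translate
    (s : CotangentSection (EuclideanSpace ℂ (Fin k) × E) (Susp ρ) m) {m₀ m₁ : M}
    (γ : Multiplicative Λ) (u : EuclideanSpace ℂ (Fin k)) {z : E} (hz : z ∈ (chartAt E m₀).target)
    (hφ : (ρ γ : M ≃ₜ M) ((chartAt E m₀).symm z) ∈ (chartAt E m₁).source)
    (f : (EuclideanSpace ℂ (Fin k) × E) →L[ℂ] ℂ) :
    plotEval s (Susp.plot ρ m₁) (γ.toAdd + u, autInCharts m₀ m₁ (ρ γ) z) f =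
      plotEval s (Susp.plot ρ m₀) (u, z)
        (f ∘L (ContinuousLinearMap.id ℂ _).prodMap (fderiv ℂ (autInCharts m₀ m₁ (ρ γ)) z)) := by
  let h : EuclideanSpace ℂ (Fin k) × E → EuclideanSpace ℂ (Fin k) × E :=
    Prod.map (fun u => γ.toAdd + u) (autInCharts m₀ m₁ (ρ γ))
  have hd := (contDiffAt_autInCharts (ρ γ) hz hφ).differentiableAt (by simp)
  have hh : HasFDerivAt h ((ContinuousLinearMap.id ℂ _).prodMap
      (fderiv ℂ (autInCharts m₀ m₁ (ρ γ)) z)) (u, z) :=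
    HasFDerivAt.prodMap (u, z) ((hasFDerivAt_id u).const_add _) hd.hasFDerivAt
  have hz' : autInCharts m₀ m₁ (ρ γ) z ∈ (chartAt E m₁).target := (chartAt E m₁).map_source hφ
  rw [← hh.fderiv]
  refine (plotEval_comp s (g' := Susp.plot ρ m₁) (h := h) (b := (u, z)) ?_
    ((Susp.contMDiffAt_plot ρ hz').mdifferentiableAt (by simp))
    (Susp.isInvertible_plotDeriv_plot ρ hz') hh.differentiableAt ?_ f).symm
  · have h1 := (continuous_snd.tendsto (u, z)).eventually (eventually_mem_autInCharts (ρ γ) hz hφ)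
    filter_upwards [h1] with b hb
    exact (Susp.plot_translate γ hb.2).symm
  · rw [hh.fderiv]
    obtain ⟨e, he⟩ := isInvertible_fderiv_autInCharts (ρ γ) hz hφ
    exact ⟨(ContinuousLinearEquiv.refl ℂ _).prodCongr e, by rw [← he]; rfl⟩

end TransitionMaps

/-! ### Uniform derivative bounds on compact sets of automorphisms -/

section UniformBounds

variable {E M : Type*} [NormedAddCommGroup E] [NormedSpace ℂ E] [TopologicalSpace M]
  [ChartedSpace E M] [T2Space M] [LocallyCompactSpace M] [IsManifold 𝓘(ℂ, E) ω M]

theorem HolAut.continuous_eval :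
    Continuous fun q : HolAut E M × M => (q.1 : M ≃ₜ M) q.2 := by
  have h : Continuous fun φ : HolAut E M => ((φ : M ≃ₜ M) : C(M, M)) := continuous_induced_dom
  exact (h.comp continuous_fst).eval continuous_snd

/-- Cauchy estimate for biholomorphic maps near a given one. -/
theorem exists_nhds_bound_fderiv_autInCharts {m₀ m₁ : M} (φ₀ : HolAut E M) {z₀ : E}
    (hz : z₀ ∈ (chartAt E m₀).target)
    (hφ : (φ₀ : M ≃ₜ M) ((chartAt E m₀).symm z₀) ∈ (chartAt E m₁).source) :
    ∃ C : ℝ, ∀ᶠ q : HolAut E M × E in 𝓝 (φ₀, z₀), ‖fderiv ℂ (autInCharts m₀ m₁ q.1) q.2‖ ≤ C := by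
  let w₀ := autInCharts m₀ m₁ φ₀ z₀
  have hev : ContinuousAt (fun q : HolAut E M × E => (q.1 : M ≃ₜ M) ((chartAt E m₀).symm q.2))
      (φ₀, z₀) :=
    HolAut.continuous_eval.continuousAt.comp (f := fun q : HolAut E M × E =>
      (q.1, (chartAt E m₀).symm q.2)) (continuousAt_fst.prodMk
      (((chartAt E m₀).continuousAt_symm hz).comp (f := Prod.snd) (x := (φ₀, z₀)) continuousAt_snd))
  have h1 : ∀ᶠ p in 𝓝 ((φ₀ : M ≃ₜ M) ((chartAt E m₀).symm z₀)),
      p ∈ (chartAt E m₁).source ∧ chartAt E m₁ p ∈ Metric.ball w₀ 1 :=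
    Filter.Eventually.and ((chartAt E m₁).open_source.mem_nhds hφ)
      (((chartAt E m₁).continuousAt hφ).eventually (Metric.ball_mem_nhds w₀ one_pos))
  have h2 : ∀ᶠ q : HolAut E M × E in 𝓝 (φ₀, z₀), q.2 ∈ (chartAt E m₀).target ∧
      (q.1 : M ≃ₜ M) ((chartAt E m₀).symm q.2) ∈ (chartAt E m₁).source ∧
      autInCharts m₀ m₁ q.1 q.2 ∈ Metric.ball w₀ 1 :=
    Filter.Eventually.and
      ((continuousAt_snd (p := (φ₀, z₀))).eventually ((chartAt E m₀).open_target.mem_nhds hz))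
      (hev.eventually h1)
  rw [nhds_prod_eq, Filter.eventually_prod_iff] at h2
  obtain ⟨pa, ha, pb, hb, hab⟩ := h2
  obtain ⟨ε, hε, hball⟩ := Metric.eventually_nhds_iff_ball.1 hb
  -- Nearby maps send the ball of radius `ε / 2` about `z` into the unit ball about `w₀`, hence into
  -- a ball of radius `2` about the image of `z`.
  refine ⟨2 / (ε / 2), ?_⟩
  rw [nhds_prod_eq, Filter.eventually_prod_iff]
  refine ⟨pa, ha, fun z => z ∈ Metric.ball z₀ (ε / 2), Metric.ball_mem_nhds _ (half_pos hε), ?_⟩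
  intro φ hφ z hz
  have hsub : Metric.ball z (ε / 2) ⊆ Metric.ball z₀ ε := by
    refine Metric.ball_subset_ball' ?_
    have := Metric.mem_ball.1 hz
    linarith
  have hzz : z ∈ Metric.ball z₀ ε := hsub (Metric.mem_ball_self (half_pos hε))
  refine Complex.norm_fderiv_le_div_of_mapsTo_ball (fun w hw => ?_) (fun w hw => ?_) (half_pos hε)
  · obtain ⟨g1, g2, -⟩ := hab hφ (hball w (hsub hw))
    exact ((contDiffAt_autInCharts φ g1 g2).differentiableAt (by simp)).differentiableWithinAt
  · have g1 := (hab hφ (hball w (hsub hw))).2.2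
    have g2 := (hab hφ (hball z hzz)).2.2
    rw [Metric.mem_ball] at g1 g2
    rw [Metric.mem_closedBall]
    exact (dist_triangle_right _ _ w₀).trans (by simp only at g1 g2 ⊢; linarith)

/-- The derivatives in charts of a compact set of biholomorphic maps are uniformly bounded. -/
theorem exists_bound_fderiv_autInCharts {K : Set (HolAut E M)} (hK : IsCompact K) {m₀ m₁ : M}
    {Q₀ Q₁ : Set E} (hQ₀ : IsCompact Q₀) (hQ₁ : IsCompact Q₁) (h₀ : Q₀ ⊆ (chartAt E m₀).target)
    (h₁ : Q₁ ⊆ (chartAt E m₁).target) :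
    ∃ C : ℝ, ∀ φ ∈ K, ∀ z ∈ Q₀,
      (φ : M ≃ₜ M) ((chartAt E m₀).symm z) ∈ (chartAt E m₁).symm '' Q₁ →
      ‖fderiv ℂ (autInCharts m₀ m₁ φ) z‖ ≤ C := by
  have hcl : IsClosed ((chartAt E m₁).symm '' Q₁) :=
    (hQ₁.image_of_continuousOn ((chartAt E m₁).continuousOn_symm.mono h₁)).isClosed
  have key : ∃ C : ℝ, ∀ q ∈ K ×ˢ Q₀,
      (q.1 : M ≃ₜ M) ((chartAt E m₀).symm q.2) ∈ (chartAt E m₁).symm '' Q₁ →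
      ‖fderiv ℂ (autInCharts m₀ m₁ q.1) q.2‖ ≤ C := by
    refine (hK.prod hQ₀).induction_on (p := fun S => ∃ C : ℝ, ∀ q ∈ S,
      (q.1 : M ≃ₜ M) ((chartAt E m₀).symm q.2) ∈ (chartAt E m₁).symm '' Q₁ →
      ‖fderiv ℂ (autInCharts m₀ m₁ q.1) q.2‖ ≤ C) ⟨0, by simp⟩ ?_ ?_ ?_
    · rintro S S' hSS' ⟨C, hC⟩
      exact ⟨C, fun q hq => hC q (hSS' hq)⟩
    · rintro S S' ⟨C, hC⟩ ⟨C', hC'⟩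
      refine ⟨max C C', fun q hq hq' => ?_⟩
      rcases hq with hq | hq
      · exact (hC q hq hq').trans (le_max_left _ _)
      · exact (hC' q hq hq').trans (le_max_right _ _)
    · rintro ⟨φ₀, z₀⟩ ⟨-, hz₀⟩
      have hz : z₀ ∈ (chartAt E m₀).target := h₀ hz₀
      -- If `φ₀` sends the point into the compact image of `Q₁`, the Cauchy estimate applies.
      -- Otherwise that image is closed, nearby pairs also miss it, and the condition is vacuous.
      by_cases hmem : (φ₀ : M ≃ₜ M) ((chartAt E m₀).symm z₀) ∈ (chartAt E m₁).symm '' Q₁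
      · have hs : (φ₀ : M ≃ₜ M) ((chartAt E m₀).symm z₀) ∈ (chartAt E m₁).source := by
          obtain ⟨w, hw, hw'⟩ := hmem
          rw [← hw']
          exact (chartAt E m₁).map_target (h₁ hw)
        obtain ⟨C, hC⟩ := exists_nhds_bound_fderiv_autInCharts φ₀ hz hs
        exact ⟨_, mem_nhdsWithin_of_mem_nhds hC, C, fun q hq _ => hq⟩
      · have hev : ContinuousAt
            (fun q : HolAut E M × E => (q.1 : M ≃ₜ M) ((chartAt E m₀).symm q.2)) (φ₀, z₀) :=
          HolAut.continuous_eval.continuousAt.comp (f := fun q : HolAut E M × E =>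
            (q.1, (chartAt E m₀).symm q.2)) (continuousAt_fst.prodMk
            (((chartAt E m₀).continuousAt_symm hz).comp (f := Prod.snd) (x := (φ₀, z₀))
              continuousAt_snd))
        exact ⟨_, mem_nhdsWithin_of_mem_nhds (hev.eventually (hcl.isOpen_compl.mem_nhds hmem)), 0,
          fun q hq hq' => absurd hq' hq⟩
  obtain ⟨C, hC⟩ := key
  exact ⟨C, fun φ hφ z hz => hC (φ, z) ⟨hφ, hz⟩⟩

variable (E M) in
theorem exists_finite_chart_balls [CompactSpace M] [ProperSpace E] :
    ∃ (t : Finset M) (r : M → ℝ), (∀ p, 0 < r p) ∧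
      (∀ p, Metric.closedBall (chartAt E p p) (r p) ⊆ (chartAt E p).target) ∧
      ∀ x, ∃ p ∈ t, x ∈ (chartAt E p).source ∧
        chartAt E p x ∈ Metric.ball (chartAt E p p) (r p / 2) := by
  have h : ∀ p : M, ∃ r : ℝ, 0 < r ∧
      Metric.closedBall (chartAt E p p) r ⊆ (chartAt E p).target := fun p =>
    Metric.nhds_basis_closedBall.mem_iff.1 ((chartAt E p).open_target.mem_nhds
      (mem_chart_target E p))
  choose r hr hsub using h
  obtain ⟨t, -, ht⟩ := isCompact_univ.elim_nhds_subcover (fun p : M => {x | x ∈ (chartAt E p).source ∧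
    chartAt E p x ∈ Metric.ball (chartAt E p p) (r p / 2)}) (fun p _ =>
    Filter.Eventually.and ((chartAt E p).open_source.mem_nhds (mem_chart_source E p))
      (((chartAt E p).continuousAt (mem_chart_source E p)).eventually
        (Metric.ball_mem_nhds _ (half_pos (hr p)))))
  refine ⟨t, r, hr, hsub, fun x => ?_⟩
  obtain ⟨p, hp, hx⟩ := Set.mem_iUnion₂.1 (ht (Set.mem_univ x))
  exact ⟨p, hp, hx⟩

end UniformBounds

/-- The closed parallelepiped of a lattice basis is compact, and integer parts of coordinates move
every vector into it. -/
theorem IsZLattice.exists_isCompact_add {E : Type*} [NormedAddCommGroup E] [NormedSpace ℝ E]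
    [FiniteDimensional ℝ E] (L : Submodule ℤ E) [DiscreteTopology L] [IsZLattice ℝ L] :
    ∃ D : Set E, IsCompact D ∧ ∀ x, ∃ l : L, ∃ y ∈ D, x = l + y := by
  have := ZLattice.module_free ℝ L
  let b := Module.Free.chooseBasis ℤ L
  refine ⟨_, (b.ofZLatticeBasis ℝ).parallelepiped.isCompact, fun x => ?_⟩
  let x' : L := b.repr.symm (Finsupp.equivFunOnFinite.symm
    fun i ↦ ⌊(b.ofZLatticeBasis ℝ).repr x i⌋)
  refine ⟨x', x + (- x'), ?_, by abel⟩
  simp [parallelepiped_basis_eq, x', Int.floor_le, Int.lt_floor_add_one, le_of_lt, add_comm (1 : ℝ)]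

/-! ### Liouville's theorem along `ℂᵏ` and restriction to one fibre -/

section SectionBound

variable {k : ℕ} {E M : Type*} [NormedAddCommGroup E] [NormedSpace ℂ E] [FiniteDimensional ℂ E]
    [TopologicalSpace M] [ChartedSpace E M] [T2Space M] [CompactSpace M]
    [IsManifold 𝓘(ℂ, E) ω M]
    {Λ : Submodule ℤ (EuclideanSpace ℂ (Fin k))} [DiscreteTopology Λ]
    (ρ : Multiplicative Λ →* HolAut E M)

/-- A finite system of chart balls of `M`, with a uniform bound for the change of covectors under the
group. -/
structure ChartBalls (t : Finset M) (r : M → ℝ) (C : ℝ) : Prop where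
  radius_pos : ∀ p, 0 < r p
  subset_target : ∀ p, Metric.closedBall (chartAt E p p) (r p) ⊆ (chartAt E p).target
  exists_mem : ∀ x, ∃ p ∈ t, x ∈ (chartAt E p).source ∧
    chartAt E p x ∈ Metric.ball (chartAt E p p) (r p / 2)
  exchange : ∀ i ∈ t, ∀ x ∈ Metric.closedBall (chartAt E i i) (r i), ∀ γ : Multiplicative Λ,
    ∃ j ∈ t, ∃ y ∈ Metric.ball (chartAt E j j) (r j / 2),
      ∃ T : ((EuclideanSpace ℂ (Fin k) × E) →L[ℂ] ℂ) → ((EuclideanSpace ℂ (Fin k) × E) →L[ℂ] ℂ),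
        (∀ f, ‖T f‖ ≤ C * ‖f‖) ∧
        ∀ (m : ℕ) (s : CotangentSection (EuclideanSpace ℂ (Fin k) × E) (Susp ρ) m) u f,
          plotEval s (Susp.plot ρ i) (γ.toAdd + u, x) f =
            plotEval s (Susp.plot ρ j) (u, y) (T f)

theorem exists_chartBalls {K : Set (HolAut E M)} (hK : IsCompact K) (hρ : ∀ γ, ρ γ ∈ K) :
    ∃ t r C, 0 ≤ C ∧ ChartBalls ρ t r C := by
  have := FiniteDimensional.proper ℂ E
  obtain ⟨t, r, hr, hsub, hcov⟩ := exists_finite_chart_balls E M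
  have hbd : ∀ i j : M, ∃ C : ℝ, ∀ φ ∈ K, ∀ z ∈ Metric.closedBall (chartAt E j j) (r j),
      (φ : M ≃ₜ M) ((chartAt E j).symm z) ∈
        (chartAt E i).symm '' Metric.closedBall (chartAt E i i) (r i) →
      ‖fderiv ℂ (autInCharts j i φ) z‖ ≤ C := fun i j =>
    exists_bound_fderiv_autInCharts hK (isCompact_closedBall _ _) (isCompact_closedBall _ _)
      (hsub j) (hsub i)
  choose C hC using hbd
  -- The `1` accounts for the identity on `ℂᵏ`, the sum for every pair of charts at once.
  refine ⟨t, r, 1 + ∑ i ∈ t, ∑ j ∈ t, |C i j|, by positivity, hr, hsub, hcov, ?_⟩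
  intro i hi x hx γ
  have hxt := hsub i hx
  let q := (chartAt E i).symm x
  -- The ball `j` is chosen around the preimage of `q` under `ρ γ`, so that `y` falls in a half
  -- ball. The derivative bound does not depend on `γ` because `ρ γ ∈ K`.
  obtain ⟨j, hj, hqs, hqb⟩ := hcov ((ρ γ : M ≃ₜ M).symm q)
  have hq : (ρ γ : M ≃ₜ M) ((chartAt E j).symm (chartAt E j ((ρ γ : M ≃ₜ M).symm q))) = q := by
    rw [(chartAt E j).left_inv hqs, Homeomorph.apply_symm_apply]
  have hx' : autInCharts j i (ρ γ) (chartAt E j ((ρ γ : M ≃ₜ M).symm q)) = x := by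
    rw [autInCharts, hq]
    exact (chartAt E i).right_inv hxt
  refine ⟨j, hj, _, hqb, fun f => f ∘L (ContinuousLinearMap.id ℂ _).prodMap
    (fderiv ℂ (autInCharts j i (ρ γ)) (chartAt E j ((ρ γ : M ≃ₜ M).symm q))), ?_, ?_⟩
  · have h1 := hC i j (ρ γ) (hρ γ) _ (Metric.ball_subset_closedBall
      (Metric.ball_subset_ball (by linarith [hr j]) hqb)) (by rw [hq]; exact ⟨x, hx, rfl⟩)
    have h2 : |C i j| ≤ ∑ i ∈ t, ∑ j ∈ t, |C i j| :=
      (Finset.single_le_sum (f := fun j => |C i j|) (fun _ _ => abs_nonneg _) hj).trans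
        (Finset.single_le_sum (f := fun i => ∑ j ∈ t, |C i j|)
          (fun _ _ => Finset.sum_nonneg fun _ _ => abs_nonneg _) hi)
    intro f
    refine (ContinuousLinearMap.opNorm_comp_le _ _).trans ?_
    rw [mul_comm]
    gcongr
    refine ContinuousLinearMap.opNorm_le_bound _ (by positivity) fun v => ?_
    rw [Prod.norm_def]
    have h0 : 0 ≤ ∑ i ∈ t, ∑ j ∈ t, |C i j| := by positivity
    refine max_le ?_ ?_
    · refine (norm_fst_le v).trans (le_mul_of_one_le_left (norm_nonneg _) (by linarith))
    · refine (ContinuousLinearMap.le_of_opNorm_le _ h1 _).trans ?_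
      have h3 : ‖v.2‖ ≤ ‖v‖ := norm_snd_le v
      have h4 : C i j ≤ 1 + ∑ i ∈ t, ∑ j ∈ t, |C i j| := by linarith [le_abs_self (C i j)]
      exact (mul_le_mul_of_nonneg_right h4 (norm_nonneg _)).trans
        (mul_le_mul_of_nonneg_left h3 (by linarith))
  · intro m s u f
    rw [← plotEval_translate s γ u ((chartAt E j).map_source hqs)
      (by rw [hq]; exact (chartAt E i).map_target hxt), hx']

variable {ρ} {t : Finset M} {r : M → ℝ} {C : ℝ} {m : ℕ}

namespace ChartBalls

theorem contDiffAt_plotEval_plot (s : CotangentSection (EuclideanSpace ℂ (Fin k) × E) (Susp ρ) m)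
    {i : M} {u : EuclideanSpace ℂ (Fin k)} {x : E} (hx : x ∈ (chartAt E i).target)
    {f : (EuclideanSpace ℂ (Fin k) × E) →L[ℂ] ℂ} (hf : f ≠ 0) :
    ContDiffAt ℂ ω (fun q : (EuclideanSpace ℂ (Fin k) × E) ×
      ((EuclideanSpace ℂ (Fin k) × E) →L[ℂ] ℂ) => plotEval s (Susp.plot ρ i) q.1 q.2) ((u, x), f) :=
  contDiffAt_plotEval s (Susp.contMDiffAt_plot ρ hx) (Susp.isInvertible_plotDeriv_plot ρ hx) hf

theorem exists_bound_plotEval (h : ChartBalls ρ t r C)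
    (s : CotangentSection (EuclideanSpace ℂ (Fin k) × E) (Susp ρ) m)
    {D : Set (EuclideanSpace ℂ (Fin k))} (hD : IsCompact D) :
    ∃ S, 0 ≤ S ∧ ∀ i ∈ t, ∀ u ∈ D, ∀ x ∈ Metric.closedBall (chartAt E i i) (r i), ∀ f,
      ‖plotEval s (Susp.plot ρ i) (u, x) f‖ ≤ S * ‖f‖ ^ m := by
  have := FiniteDimensional.proper ℂ E
  have := FiniteDimensional.proper ℂ ((EuclideanSpace ℂ (Fin k) × E) →L[ℂ] ℂ)
  have h1 : ∀ i, ∃ S, ∀ q ∈ (D ×ˢ Metric.closedBall (chartAt E i i) (r i)) ×ˢ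
      Metric.sphere (0 : (EuclideanSpace ℂ (Fin k) × E) →L[ℂ] ℂ) 1,
      ‖plotEval s (Susp.plot ρ i) q.1 q.2‖ ≤ S := fun i =>
    ((hD.prod (isCompact_closedBall _ _)).prod (isCompact_sphere _ _)).exists_bound_of_continuousOn
      fun q hq => (contDiffAt_plotEval_plot s (h.subset_target i hq.1.2)
        (fun h => by simpa [h] using hq.2)).continuousAt.continuousWithinAt
  choose S hS using h1
  refine ⟨∑ i ∈ t, |S i|, by positivity, fun i hi u hu x hx f => ?_⟩
  refine norm_le_mul_pow_of_homogeneous (fun a f ha => plotEval_smul s _ _ f ha)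
    (plotEval_zero s _ _) (by positivity) (fun f hf => ?_) f
  exact (hS i ((u, x), f) ⟨⟨hu, hx⟩, by simpa using hf⟩).trans ((le_abs_self _).trans
    (Finset.single_le_sum (f := fun i => |S i|) (fun _ _ => abs_nonneg _) hi))

/-- By Liouville's theorem, sections are constant along `ℂᵏ`. -/
theorem plotEval_eq [IsZLattice ℝ Λ] (h : ChartBalls ρ t r C)
    (s : CotangentSection (EuclideanSpace ℂ (Fin k) × E) (Susp ρ) m)
    {i : M} (hi : i ∈ t) {x : E} (hx : x ∈ Metric.closedBall (chartAt E i i) (r i))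
    (f : (EuclideanSpace ℂ (Fin k) × E) →L[ℂ] ℂ) (u : EuclideanSpace ℂ (Fin k)) :
    plotEval s (Susp.plot ρ i) (u, x) f = plotEval s (Susp.plot ρ i) (0, x) f := by
  rcases eq_or_ne f 0 with rfl | hf
  · rw [plotEval_zero, plotEval_zero]
  have hd : Differentiable ℂ fun u => plotEval s (Susp.plot ρ i) (u, x) f := fun u =>
    ((contDiffAt_plotEval_plot s (h.subset_target i hx) hf).differentiableAt (by simp)).comp
      (f := fun u => ((u, x), f)) u (by fun_prop)
  refine hd.apply_eq_apply_of_bounded ?_ u 0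
  obtain ⟨D, hD, hcov⟩ := IsZLattice.exists_isCompact_add Λ
  obtain ⟨S, hS0, hS⟩ := h.exists_bound_plotEval s hD
  refine isBounded_iff_forall_norm_le.2 ⟨S * (C * ‖f‖) ^ m, ?_⟩
  rintro _ ⟨v, rfl⟩
  -- The lattice part `l` is absorbed by the exchange with `γ = l`, which leaves `y` in the compact
  -- set `D`.
  obtain ⟨l, y, hy, rfl⟩ := hcov v
  obtain ⟨j, hj, z, hz, T, hT, hs⟩ := h.exchange i hi x hx (Multiplicative.ofAdd l)
  have h1 := hs m s y f
  rw [toAdd_ofAdd] at h1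
  simp only [h1]
  have hr := h.radius_pos j
  refine (hS j hj y hy z (Metric.ball_subset_closedBall
    (Metric.ball_subset_ball (by linarith) hz)) _).trans ?_
  gcongr
  exact hT f

/-- The restriction of sections to `0 ∈ ℂᵏ`. -/
def fibreEval (i : t) : CotangentSection (EuclideanSpace ℂ (Fin k) × E) (Susp ρ) m →ₗ[ℂ]
    (E → ((EuclideanSpace ℂ (Fin k) × E) →L[ℂ] ℂ) → ℂ) :=
  LinearMap.funLeft ℂ (((EuclideanSpace ℂ (Fin k) × E) →L[ℂ] ℂ) → ℂ)
    (fun x : E => ((0 : EuclideanSpace ℂ (Fin k)), x)) ∘ₗ plotEvalLinear m (Susp.plot ρ (i : M))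

set_option synthInstance.maxHeartbeats 400000 in
theorem homogeneousSystem [IsZLattice ℝ Λ] (h : ChartBalls ρ t r C) :
    HomogeneousSystem (fibreEval (ρ := ρ) (t := t) (m := m)) (fun i => chartAt E (i : M) (i : M))
      (fun i => r i) C m where
  radius_pos i := h.radius_pos i.1
  contDiffAt i s x hx f hf := by
    have h1 := contDiffAt_plotEval_plot s (u := 0) (h.subset_target i hx) hf
    exact h1.comp (f := fun q : E × ((EuclideanSpace ℂ (Fin k) × E) →L[ℂ] ℂ) =>
      (((0 : EuclideanSpace ℂ (Fin k)), q.1), q.2)) (x, f) (by fun_prop)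
  homogeneous i s x a f ha := plotEval_smul s _ _ f ha
  apply_zero i s x := plotEval_zero s _ _
  exchange i x hx := by
    -- With `γ = 1` there is no translation: the exchange only passes from a full ball to a half
    -- ball of another chart.
    obtain ⟨j, hj, y, hy, T, hT, hs⟩ := h.exchange i i.2 x hx 1
    refine ⟨⟨j, hj⟩, y, hy, T, hT, fun s f => ?_⟩
    have := hs m s 0 f
    rwa [toAdd_one, Submodule.coe_zero, add_zero] at this
  ext s hs := by
    refine eq_zero_of_covEval s fun p w => ?_
    obtain ⟨⟨u, q⟩, rfl⟩ := Susp.proj_surjective ρ p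
    obtain ⟨i, hi, hq, hqb⟩ := h.exists_mem q
    have hr := h.radius_pos i
    have hqb' := Metric.ball_subset_closedBall (Metric.ball_subset_ball
      (show r i / 2 ≤ r i by linarith) hqb)
    have hp : Susp.plot ρ i (u, chartAt E i q) = Susp.proj ρ (u, q) := by
      rw [Susp.plot, (chartAt E i).left_inv hq]
    -- Any covector on the quotient is seen in some plot at `(u, x)`; constancy along `ℂᵏ` moves it
    -- to `u = 0`, where `s` vanishes by hypothesis.
    rw [← hp, covEval_eq_plotEval s
      (Susp.isInvertible_plotDeriv_plot ρ (b := (u, chartAt E i q)) ((chartAt E i).map_source hq)),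
      h.plotEval_eq s hi hqb']
    exact hs ⟨i, hi⟩ _ hqb' _

end ChartBalls

end SectionBound

/-! ### Dimension count and conclusion -/

theorem finrank_continuousDual (B : Type*) [NormedAddCommGroup B] [NormedSpace ℂ B]
    [FiniteDimensional ℂ B] : Module.finrank ℂ (B →L[ℂ] ℂ) = Module.finrank ℂ B := by
  rw [← (LinearMap.toContinuousLinearMap (𝕜 := ℂ) (E := B) (F' := ℂ)).finrank_eq]
  exact Subspace.dual_finrank_eq

theorem exists_hZero_le {k : ℕ} (hk : 0 < k) {E M : Type*} [NormedAddCommGroup E]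
    [NormedSpace ℂ E] [FiniteDimensional ℂ E] [TopologicalSpace M] [ChartedSpace E M] [T2Space M]
    [CompactSpace M] [IsManifold 𝓘(ℂ, E) ω M]
    {Λ : Submodule ℤ (EuclideanSpace ℂ (Fin k))} [DiscreteTopology Λ] [IsZLattice ℝ Λ]
    (ρ : Multiplicative Λ →* HolAut E M) {K : Set (HolAut E M)} (hK : IsCompact K)
    (hρ : ∀ γ, ρ γ ∈ K) :
    ∃ N A : ℕ, ∀ m : ℕ, Cardinal.toENat (Module.rank ℂ
      (CotangentSection (EuclideanSpace ℂ (Fin k) × E) (Susp ρ) m)) ≤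
      ((N * (A * m + 1) ^ (Module.finrank ℂ E + (k + Module.finrank ℂ E - 1)) : ℕ) : ℕ∞) := by
  obtain ⟨t, r, C, hC, h⟩ := exists_chartBalls ρ hK hρ
  obtain ⟨A, hA⟩ := pow_unbounded_of_one_lt (6 * C) (one_lt_two : (1 : ℝ) < 2)
  -- As `k > 0`, a coordinate form on `ℂᵏ` and evaluation at its dual vector give a normalized pair
  -- `f₀`, `e`.
  let a : Fin k := ⟨0, hk⟩
  let v : EuclideanSpace ℂ (Fin k) × E := (EuclideanSpace.single a 1, 0)
  let f₀ : (EuclideanSpace ℂ (Fin k) × E) →L[ℂ] ℂ :=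
    (EuclideanSpace.proj a) ∘L ContinuousLinearMap.fst ℂ _ _
  let e : ((EuclideanSpace ℂ (Fin k) × E) →L[ℂ] ℂ) →L[ℂ] ℂ := ContinuousLinearMap.apply ℂ ℂ v
  have hv : ‖v‖ ≤ 1 := by simp [v, Prod.norm_def]
  have he : e f₀ = 1 := by simp [e, f₀, v]
  have hf₀ : ‖f₀‖ ≤ 1 := ContinuousLinearMap.opNorm_le_bound _ zero_le_one fun w => by
    rw [one_mul]
    exact (PiLp.norm_apply_le w.1 a).trans (norm_fst_le w)
  have he' : ‖e‖ ≤ 1 := ContinuousLinearMap.opNorm_le_bound _ zero_le_one fun f => by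
    rw [one_mul]
    exact (f.le_opNorm v).trans (mul_le_of_le_one_right (norm_nonneg _) hv)
  have hdim : Module.finrank ℂ ((EuclideanSpace ℂ (Fin k) × E) →L[ℂ] ℂ) =
      k + Module.finrank ℂ E := by
    rw [finrank_continuousDual, Module.finrank_prod, finrank_euclideanSpace_fin]
  refine ⟨Fintype.card t, A, fun m => ?_⟩
  rw [← hdim]
  exact (h.homogeneousSystem (m := m)).rank_le hC he hf₀ he' hA.le

theorem exists_mul_lt_pow {C : ℝ} (hC : 0 < C) (N A D k d m₀ : ℕ) (hk : 0 < k) (hd : 0 < d) :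
    ∃ m : ℕ, m₀ ≤ m ∧ d ∣ m ∧ ((N * (A * m + 1) ^ D : ℕ) : ℝ) < C * (m : ℝ) ^ (k + D) := by
  -- For `m ≥ 1` the left side is at most `N * (A + 1) ^ D * m ^ D`, so `m ≥ n` suffices, as `n ≤ m
  -- ≤ m ^ k`.
  obtain ⟨n, hn⟩ := exists_nat_gt ((N * (A + 1) ^ D : ℕ) / C : ℝ)
  rw [div_lt_iff₀ hC] at hn
  have hle : ∀ x ∈ ({m₀, n, 1} : Set ℕ), x ≤ d * (m₀ + n + 1) := by
    rintro x (rfl | rfl | rfl) <;> nlinarith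
  refine ⟨d * (m₀ + n + 1), hle _ (by simp), Dvd.intro _ rfl, ?_⟩
  have h1 : 1 ≤ d * (m₀ + n + 1) := hle _ (by simp)
  have h2 : n ≤ d * (m₀ + n + 1) := hle _ (by simp)
  generalize d * (m₀ + n + 1) = m at h1 h2
  have h3 : N * (A * m + 1) ^ D ≤ N * (A + 1) ^ D * m ^ D := by
    rw [mul_assoc, ← mul_pow]
    gcongr
    nlinarith
  have h1' : (1 : ℝ) ≤ m := by exact_mod_cast h1
  have h2' : (n : ℝ) ≤ m := by exact_mod_cast h2
  calc ((N * (A * m + 1) ^ D : ℕ) : ℝ) ≤ ((N * (A + 1) ^ D * m ^ D : ℕ) : ℝ) := by exact_mod_cast h3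
    _ = ((N * (A + 1) ^ D : ℕ) : ℝ) * (m : ℝ) ^ D := by push_cast; ring
    _ < n * C * (m : ℝ) ^ D := by gcongr
    _ ≤ (m : ℝ) ^ k * C * (m : ℝ) ^ D := by
      gcongr
      exact h2'.trans (le_self_pow₀ h1' hk.ne')
    _ = C * (m : ℝ) ^ (k + D) := by rw [pow_add]; ring

end

theorem propositionp {k d : ℕ} (hk : 0 < k)
    (Λ : Submodule ℤ (EuclideanSpace ℂ (Fin k))) [DiscreteTopology Λ] [IsZLattice ℝ Λ]
    {M : Type*} [TopologicalSpace M] [T2Space M] [CompactSpace M] [ConnectedSpace M]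
    [ChartedSpace (EuclideanSpace ℂ (Fin d)) M] [IsManifold 𝓘(ℂ, EuclideanSpace ℂ (Fin d)) ω M]
    (ρ : Multiplicative Λ →* HolAut (EuclideanSpace ℂ (Fin d)) M)
    (K : Subgroup (HolAut (EuclideanSpace ℂ (Fin d)) M))
    (hK : IsCompact (K : Set (HolAut (EuclideanSpace ℂ (Fin d)) M)))
    (hρ : ∀ γ, ρ γ ∈ K) :
    ¬ HasBigTangentBundle (EuclideanSpace ℂ (Fin k) × EuclideanSpace ℂ (Fin d)) (Susp ρ) := by
  rintro ⟨C, hC, d₀, hd₀, m₀, h⟩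
  obtain ⟨N, A, hNA⟩ := exists_hZero_le hk ρ hK hρ
  obtain ⟨m, hm, hdm, hlt⟩ := exists_mul_lt_pow hC N A (d + (k + d - 1)) k d₀ m₀ hk hd₀
  have h1 := h m hm hdm
  have h2 : hZero ((EuclideanSpace ℂ (Fin k) × EuclideanSpace ℂ (Fin d)) ×
      (Fin (Module.finrank ℂ ((EuclideanSpace ℂ (Fin k) × EuclideanSpace ℂ (Fin d)) →L[ℂ] ℂ) - 1) →
        ℂ)) (lineTensorPower (ProjBundle.hyperplaneBundle _ _ _) m) ≤
      ((N * (A * m + 1) ^ (Module.finrank ℂ (EuclideanSpace ℂ (Fin d)) +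
        (k + Module.finrank ℂ (EuclideanSpace ℂ (Fin d)) - 1)) : ℕ) : ℕ∞) := hNA m
  have h3 := h1.trans (ENat.toENNReal_le.2 h2)
  -- The dimension of the projectivized bundle is rewritten as `k` plus the exponent of the upper
  -- bound.
  rw [Module.finrank_prod, Module.finrank_fin_fun, finrank_continuousDual, Module.finrank_prod,
    finrank_euclideanSpace_fin, finrank_euclideanSpace_fin,
    show k + d + (k + d - 1) = k + (d + (k + d - 1)) by omega, ENat.toENNReal_coe,
    ← ENNReal.ofReal_natCast] at h3
  exact absurd hlt (not_lt.2 ((ENNReal.ofReal_le_ofReal_iff (Nat.cast_nonneg _)).1 h3))
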